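/- Let $\mathsf{RCA}_0$ be the classical two-sorted theory with variables for natural numbers and for functions $\mathbb N\to\mathbb N$, whose axioms are the usual axioms for zero, successor, addition and multiplication, the defining equations for primitive recursion (with number and function parameters), $\lambda$-abstraction, induction for quantifier-free formulas, and the scheme $\mathsf{QF}\text{-}\mathsf{AC}^{0,0}$: $\forall x\,\exists y\,A_0(x,y)\to\exists Y\,\forall x\,A_0(x,Y(x))$ for quantifier-free $A_0$ (with parameters). Let $\mathsf{RCA}$ be $\mathsf{RCA}_0$ together with induction for all formulas of this language. Real numbers are represented by sequences of rationals $\langle x_k\rangle$ with $|x_k-x_{k+i}|\le 2^{-k}$ for all $k,i$, and complex numbers by pairs of real numbers. A Jordan decomposition of a $2\times 2$ matrix $M$ is a pair $(U,J)$ of complex $2\times2$ matrices such that $U$ is invertible, $M=UJU^{-1}$, and $J$ consists of Jordan blocks, that is, $J=\begin{pmatrix}a&0\\0&b\end{pmatrix}$ or $J=\begin{pmatrix}a&1\\0&a\end{pmatrix}$. Then the following principle implies the arithmetical comprehension scheme over $\mathsf{RCA}_0$ (and hence over $\mathsf{RCA}$): for every sequence $\langle M_i\mid i\in\mathbb N\rangle$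 of $2\times2$ real matrices such that each $M_i$ has only real eigenvalues, there are sequences $\langle U_i\mid i\in\mathbb N\rangle$ and $\langle J_i\mid i\in\mathbb N\rangle$ such that $(U_i,J_i)$ is a Jordan decomposition of $M_i$ for all $i\in\mathbb N$. That is: every model of $\mathsf{RCA}_0$ (respectively $\mathsf{RCA}$), with arbitrary, possibly nonstandard, first-order part, in which this principle holds is a model of arithmetical comprehension: for every formula $A(x)$ without function quantifiers (with number and function parameters) the characteristic function of $\{x\mid A(x)\}$ exists. Equivalently, by the completeness theorem, $\mathsf{RCA}_0$ (respectively $\mathsf{RCA}$) together with the principle proves every instance of the scheme. -/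

import Mathlib

universe u

/-! ### The two-sorted language of numbers (type `0`) and functions (type `0 → 0`) -/

/-- Terms of type `0`. Number variables and function variables are numbered separately (de Bruijn).
`prec b s n` is primitive recursion with start value `b`, step `s` and argument `n`; it binds two
number variables in `s`: variable `0` is the previous value and variable `1` the previous stage.
These are the normal forms of the terms built from `0`, successor, addition, multiplication, the
recursor of type `0`, application and `λ`-abstraction, when all variables have type `0` or `1`. -/
inductive ArithTerm : Type
  | var (i : ℕ)
  | zero
  | succ (t : ArithTerm)
  | add (s t : ArithTerm)
  | mul (s t : ArithTerm)
  | app (f : ℕ) (t : ArithTerm)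
  | prec (b s n : ArithTerm)

/-- Formulas. Equality is primitive for numbers only; `all`, `ex` quantify over numbers and
`allFun`, `exFun` over functions. -/
inductive ArithFormula : Type
  | eq (s t : ArithTerm)
  | falsum
  | and (A B : ArithFormula)
  | or (A B : ArithFormula)
  | imp (A B : ArithFormula)
  | all (A : ArithFormula)
  | ex (A : ArithFormula)
  | allFun (A : ArithFormula)
  | exFun (A : ArithFormula)

namespace ArithFormula

def IsQuantifierFree : ArithFormula → Prop
  | eq _ _ => True
  | falsum => True
  | and A B => A.IsQuantifierFree ∧ B.IsQuantifierFree
  | or A B => A.IsQuantifierFree ∧ B.IsQuantifierFree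
  | imp A B => A.IsQuantifierFree ∧ B.IsQuantifierFree
  | all _ => False
  | ex _ => False
  | allFun _ => False
  | exFun _ => False

/-- No quantifiers over functions (function parameters are allowed). -/
def IsArithmetical : ArithFormula → Prop
  | eq _ _ => True
  | falsum => True
  | and A B => A.IsArithmetical ∧ B.IsArithmetical
  | or A B => A.IsArithmetical ∧ B.IsArithmetical
  | imp A B => A.IsArithmetical ∧ B.IsArithmetical
  | all A => A.IsArithmetical
  | ex A => A.IsArithmetical
  | allFun _ => False
  | exFun _ => False

end ArithFormula

/-- A structure for the two-sorted language: an arbitrary (possibly nonstandard) first-order part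
`N` and an arbitrary nonempty collection `Fn` of functions `N → N`, the range of the function variables.
`recur b s n` interprets the recursor; only its values at steps `s` given by terms matter. -/
structure ArithStructure where
  N : Type u
  zero : N
  succ : N → N
  add : N → N → N
  mul : N → N → N
  recur : N → (N → N → N) → N → N
  Fn : Set (N → N)
  fn_nonempty : Fn.Nonempty

namespace ArithStructure

/-- Extend an assignment by a value for variable `0`, shifting the others. -/
def push {α : Type u} (a : α) (e : ℕ → α) : ℕ → α
  | 0 => a
  | i + 1 => e i

variable (M : ArithStructure.{u})

instance : Zero M.N := ⟨M.zero⟩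
instance : Add M.N := ⟨M.add⟩
instance : Mul M.N := ⟨M.mul⟩

/-- The value of a term at an assignment `e` of numbers and `g` of functions. -/
def eval (g : ℕ → M.Fn) : (ℕ → M.N) → ArithTerm → M.N
  | e, .var i => e i
  | _, .zero => 0
  | e, .succ t => M.succ (eval g e t)
  | e, .add s t => eval g e s + eval g e t
  | e, .mul s t => eval g e s * eval g e t
  | e, .app f t => (g f : M.N → M.N) (eval g e t)
  | e, .prec b s n =>
      M.recur (eval g e b) (fun a k => eval g (push a (push k e)) s) (eval g e n)

/-- Classical (Tarskian) satisfaction; function quantifiers range over `M.Fn`. -/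
def Sat : (ℕ → M.Fn) → (ℕ → M.N) → ArithFormula → Prop
  | g, e, .eq s t => M.eval g e s = M.eval g e t
  | _, _, .falsum => False
  | g, e, .and A B => Sat g e A ∧ Sat g e B
  | g, e, .or A B => Sat g e A ∨ Sat g e B
  | g, e, .imp A B => Sat g e A → Sat g e B
  | g, e, .all A => ∀ x : M.N, Sat g (push x e) A
  | g, e, .ex A => ∃ x : M.N, Sat g (push x e) A
  | g, e, .allFun A => ∀ f : M.Fn, Sat (push f g) e A
  | g, e, .exFun A => ∃ f : M.Fn, Sat (push f g) e A

/-- The induction axiom for the formula `A` (in variable `0`), with all parameters. -/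
def InductionFor (A : ArithFormula) : Prop :=
  ∀ (g : ℕ → M.Fn) (e : ℕ → M.N), M.Sat g (push 0 e) A →
    (∀ x : M.N, M.Sat g (push x e) A → M.Sat g (push (M.succ x) e) A) →
      ∀ x : M.N, M.Sat g (push x e) A

/-- `M` is a model of `RCA₀` in its function-based form: arithmetic with primitive recursion of
type `0`, `λ`-abstraction, quantifier-free induction and `QF-AC^{0,0}`, in classical logic. -/
structure IsModelRCA0 : Prop where
  succ_ne_zero : ∀ x : M.N, M.succ x ≠ 0
  succ_inj : ∀ x y : M.N, M.succ x = M.succ y → x = y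
  add_zero : ∀ x : M.N, x + 0 = x
  add_succ : ∀ x y : M.N, x + M.succ y = M.succ (x + y)
  mul_zero : ∀ x : M.N, x * 0 = 0
  mul_succ : ∀ x y : M.N, x * M.succ y = x * y + x
  recur_zero : ∀ (s : ArithTerm) (g : ℕ → M.Fn) (e : ℕ → M.N) (b : M.N),
    M.recur b (fun a k => M.eval g (push a (push k e)) s) 0 = b
  recur_succ : ∀ (s : ArithTerm) (g : ℕ → M.Fn) (e : ℕ → M.N) (b n : M.N),
    M.recur b (fun a k => M.eval g (push a (push k e)) s) (M.succ n) =
      M.eval g (push (M.recur b (fun a k => M.eval g (push a (push k e)) s) n) (push n e)) s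
  abstraction : ∀ (t : ArithTerm) (g : ℕ → M.Fn) (e : ℕ → M.N),
    (fun x => M.eval g (push x e) t) ∈ M.Fn
  qf_induction : ∀ A : ArithFormula, A.IsQuantifierFree → M.InductionFor A
  qf_choice : ∀ A : ArithFormula, A.IsQuantifierFree → ∀ (g : ℕ → M.Fn) (e : ℕ → M.N),
    (∀ x : M.N, ∃ y : M.N, M.Sat g (push y (push x e)) A) →
      ∃ Y : M.Fn, ∀ x : M.N, M.Sat g (push ((Y : M.N → M.N) x) (push x e)) A

/-- `M` is a model of `RCA`, that is, of `RCA₀` with induction for all formulas. -/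
structure IsModelRCA : Prop extends M.IsModelRCA0 where
  full_induction : ∀ A : ArithFormula, M.InductionFor A

/-- The arithmetical comprehension scheme; sets are given by characteristic functions. -/
def ArithmeticalComprehension : Prop :=
  ∀ A : ArithFormula, A.IsArithmetical → ∀ (g : ℕ → M.Fn) (e : ℕ → M.N),
    ∃ χ : M.Fn, ∀ x : M.N,
      (M.Sat g (push x e) A → (χ : M.N → M.N) x = M.succ 0) ∧
      (¬ M.Sat g (push x e) A → (χ : M.N → M.N) x = 0)

/-! ### Rational, real and complex numbers inside a structure

All quantifiers below range over `M.N` and over (finite tuples of) elements of `M.Fn`. -/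

def le (a b : M.N) : Prop := ∃ c : M.N, a + c = b

/-- The (injective) pairing function `(i + k)² + i`. -/
def pair (i k : M.N) : M.N := (i + k) * (i + k) + i

/-- `2 ^ k`, by primitive recursion. -/
def pow2 (k : M.N) : M.N := M.recur (M.succ 0) (fun a _ => a + a) k

/-- A code of the rational number `(pos - neg) / (den + 1)`. -/
@[ext] structure Frac where
  pos : M.N
  neg : M.N
  den : M.N

namespace Frac

variable {M}

instance : Zero (Frac M) := ⟨⟨0, 0, 0⟩⟩
instance : One (Frac M) := ⟨⟨M.succ 0, 0, 0⟩⟩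

/-- The denominator of the sum and of the product is `(p.den + 1) * (q.den + 1)`. -/
instance : Add (Frac M) := ⟨fun p q =>
  ⟨p.pos * M.succ q.den + q.pos * M.succ p.den,
   p.neg * M.succ q.den + q.neg * M.succ p.den,
   p.den * q.den + p.den + q.den⟩⟩
instance : Neg (Frac M) := ⟨fun p => ⟨p.neg, p.pos, p.den⟩⟩
instance : Sub (Frac M) := ⟨fun p q => p + -q⟩
instance : Mul (Frac M) := ⟨fun p q =>
  ⟨p.pos * q.pos + p.neg * q.neg, p.pos * q.neg + p.neg * q.pos,
   p.den * q.den + p.den + q.den⟩⟩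

/-- `|p| ≤ 1 / m` (for `m ≠ 0`). -/
def AbsLeInv (p : Frac M) (m : M.N) : Prop :=
  M.le (p.pos * m) (p.neg * m + M.succ p.den) ∧ M.le (p.neg * m) (p.pos * m + M.succ p.den)

end Frac

/-- A code of the complex rational number `re + i * im`. -/
@[ext] structure CFrac where
  re : Frac M
  im : Frac M

namespace CFrac

variable {M}

instance : Zero (CFrac M) := ⟨⟨0, 0⟩⟩
instance : One (CFrac M) := ⟨⟨1, 0⟩⟩
instance : Add (CFrac M) := ⟨fun p q => ⟨p.re + q.re, p.im + q.im⟩⟩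
instance : Sub (CFrac M) := ⟨fun p q => ⟨p.re - q.re, p.im - q.im⟩⟩
instance : Mul (CFrac M) := ⟨fun p q =>
  ⟨p.re * q.re - p.im * q.im, p.re * q.im + p.im * q.re⟩⟩

end CFrac

section Sequences

variable {M}

/-- Quick convergence: `|x_k - x_{k+i}| ≤ 2^{-k}` for all `k` and `i`. -/
def IsQuick (x : M.N → Frac M) : Prop :=
  ∀ k i : M.N, (x k - x (k + i)).AbsLeInv (M.pow2 k)

/-- Convergence to `0`. -/
def IsNull (x : M.N → Frac M) : Prop :=
  ∀ m : M.N, ∃ K : M.N, ∀ k : M.N, M.le K k → (x k).AbsLeInv (M.succ m)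

/-- Equality of the complex numbers represented by two sequences: the difference tends to `0`.
Sums and products of complex numbers are represented by termwise sums and products. -/
def CEq (x y : M.N → CFrac M) : Prop :=
  IsNull (fun k => (x k - y k).re) ∧ IsNull (fun k => (x k - y k).im)

end Sequences

/-- Three functions of the structure, coding a sequence of rational numbers. -/
structure RatSeq where
  pos : M.Fn
  neg : M.Fn
  den : M.Fn

/-- The `k`-th rational number of a coded sequence. -/
def RatSeq.term {M : ArithStructure.{u}} (x : RatSeq M) (k : M.N) : Frac M :=
  ⟨(x.pos : M.N → M.N) k, (x.neg : M.N → M.N) k, (x.den : M.N → M.N) k⟩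

/-- The `k`-th rational number of the `i`-th sequence of a coded sequence of sequences. -/
def RatSeq.row {M : ArithStructure.{u}} (x : RatSeq M) (i k : M.N) : Frac M :=
  x.term (M.pair i k)

/-- A coded sequence of complex rational numbers. -/
structure CRatSeq where
  re : RatSeq M
  im : RatSeq M

def CRatSeq.term {M : ArithStructure.{u}} (z : CRatSeq M) (k : M.N) : CFrac M :=
  ⟨z.re.term k, z.im.term k⟩

def CRatSeq.row {M : ArithStructure.{u}} (z : CRatSeq M) (i k : M.N) : CFrac M :=
  ⟨z.re.row i k, z.im.row i k⟩

section Matrices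

variable {M}

/-- `z` is a complex number: its real and imaginary parts are quickly converging. -/
def CRatSeq.IsComplex (z : CRatSeq M) : Prop := IsQuick z.re.term ∧ IsQuick z.im.term

/-- `z` is a sequence of complex numbers. -/
def CRatSeq.IsComplexSeq (z : CRatSeq M) : Prop :=
  ∀ i : M.N, IsQuick (z.re.row i) ∧ IsQuick (z.im.row i)

/-- A `2 × 2` matrix whose entries are sequences of complex rational numbers. -/
abbrev Mat2 (M : ArithStructure.{u}) := Fin 2 → Fin 2 → M.N → CFrac M

namespace Mat2

def mul (A B : Mat2 M) : Mat2 M := fun r c k => A r 0 k * B 0 c k + A r 1 k * B 1 c k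

def one : Mat2 M := fun r c _ => if r = c then 1 else 0

/-- Equality of the represented complex matrices. -/
def MEq (A B : Mat2 M) : Prop := ∀ r c, CEq (A r c) (B r c)

/-- `J` consists of Jordan blocks: two blocks of size one, or a single block of size two. -/
def IsJordanForm (J : Mat2 M) : Prop :=
  (CEq (J 0 1) (fun _ => 0) ∧ CEq (J 1 0) (fun _ => 0)) ∨
  (CEq (J 0 0) (J 1 1) ∧ CEq (J 0 1) (fun _ => 1) ∧ CEq (J 1 0) (fun _ => 0))

/-- `(U, J)` is a Jordan decomposition of `A`: `A = U J U⁻¹`, where `U` has an inverse `V` in the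
structure and `J` consists of Jordan blocks. -/
def IsJordanDecomposition (A U J : Mat2 M) : Prop :=
  IsJordanForm J ∧ ∃ V : Fin 2 → Fin 2 → CRatSeq M, (∀ r c, (V r c).IsComplex) ∧
    MEq (mul U fun r c => (V r c).term) one ∧ MEq (mul (fun r c => (V r c).term) U) one ∧
    MEq A (mul (mul U J) fun r c => (V r c).term)

/-- Every complex eigenvalue of `A` (with an eigenvector `v ≠ 0` in `ℂ²`) is real. -/
def HasOnlyRealEigenvalues (A : Mat2 M) : Prop :=
  ∀ (l : CRatSeq M) (v : Fin 2 → CRatSeq M), l.IsComplex → (∀ r, (v r).IsComplex) →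
    ¬ (∀ r, CEq (v r).term (fun _ => 0)) →
    (∀ r, CEq (fun k => A r 0 k * (v 0).term k + A r 1 k * (v 1).term k)
      (fun k => l.term k * (v r).term k)) →
    IsNull l.im.term

end Mat2

end Matrices

/-- For every sequence `A` of `2 × 2` real matrices with only real eigenvalues there are sequences
`U` and `J` of (complex) matrices such that `(U_i, J_i)` is a Jordan decomposition of `A_i` for all
`i`. Each entry of a sequence of matrices is a coded sequence of numbers. -/
def SequentialJordanPrinciple : Prop :=
  ∀ A : Fin 2 → Fin 2 → RatSeq M,
    (∀ r c i, IsQuick ((A r c).row i)) →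
    (∀ i, Mat2.HasOnlyRealEigenvalues (fun r c k => (⟨(A r c).row i k, 0⟩ : CFrac M))) →
    ∃ U J : Fin 2 → Fin 2 → CRatSeq M,
      (∀ r c, (U r c).IsComplexSeq) ∧ (∀ r c, (J r c).IsComplexSeq) ∧
      ∀ i, Mat2.IsJordanDecomposition (fun r c k => (⟨(A r c).row i k, 0⟩ : CFrac M))
        (fun r c => (U r c).row i) (fun r c => (J r c).row i)

end ArithStructure

/-! Over an arbitrary model it suffices to obtain `SigmaComprehension`, since arithmetical
comprehension follows by induction on formulas, one application per number quantifier
(`SigmaComprehension.decid_sat`).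

Given `f` in the model, `exists_search_real` builds, uniformly in `i`, a real `x_i` that vanishes
exactly when `f (i, k) ≠ 0` for all `k`. The matrix `(0, x_i; 0, 0)` squares to zero, so its only
eigenvalue is `0` and the principle applies. If `x_i = 0`, then `J_i = 0`. If `x_i ≠ 0`, then `J_i`
cannot be diagonal, hence is a block of size two (`jordan_nilpotent_dichotomy`). So the upper right
entry of `J_i` is `0` or `1`, and one rational approximation with error below `1/2` decides which
(`re_approx_separates_zero_one`). Jordan decomposition is discontinuous, and the sequence of `J_i`
converts this into a decision procedure.

The first-order part may be nonstandard, so every induction concerns a predicate with a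
characteristic function in the model (`Decid.induct`). Complex numbers are handled without
constructing their field: equality of represented numbers is equality in `LimitRing`, the bounded
sequences of complex rationals modulo null ones (`ceq_iff`). The sequences there are arbitrary and
need not lie in the model. This ring is reduced, and a quickly converging sequence with nonzero
limit is not a zero divisor in it; no more is needed. -/

namespace ArithStructure

variable {M : ArithStructure.{u}}

/-! ### Arithmetic in a model of `RCA₀` -/

section Arithmetic

set_option linter.unusedSectionVars false

variable [hM : Fact M.IsModelRCA0]

/-- An arbitrary assignment of functions. -/
noncomputable def someFns (M : ArithStructure.{u}) : ℕ → M.Fn :=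
  fun _ => ⟨_, M.fn_nonempty.some_mem⟩

theorem induct_eq (s t : ArithTerm) (g : ℕ → M.Fn) (e : ℕ → M.N)
    (h0 : M.eval g (push 0 e) s = M.eval g (push 0 e) t)
    (hs : ∀ x, M.eval g (push x e) s = M.eval g (push x e) t →
      M.eval g (push (M.succ x) e) s = M.eval g (push (M.succ x) e) t) (x : M.N) :
    M.eval g (push x e) s = M.eval g (push x e) t :=
  hM.out.qf_induction (.eq s t) trivial g e h0 hs x

theorem add_zero' (x : M.N) : x + 0 = x := hM.out.add_zero x
theorem add_succ' (x y : M.N) : x + M.succ y = M.succ (x + y) := hM.out.add_succ x y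
theorem mul_zero' (x : M.N) : x * 0 = 0 := hM.out.mul_zero x
theorem mul_succ' (x y : M.N) : x * M.succ y = x * y + x := hM.out.mul_succ x y

theorem zero_add' (x : M.N) : 0 + x = x :=
  induct_eq (.add .zero (.var 0)) (.var 0) (someFns M) (fun _ => 0) (add_zero' _)
    (fun x hx => by simp only [eval, push] at hx ⊢; rw [add_succ', hx]) x

theorem succ_add' (y x : M.N) : M.succ y + x = M.succ (y + x) :=
  induct_eq (.add (.succ (.var 1)) (.var 0)) (.succ (.add (.var 1) (.var 0))) (someFns M)
    (fun _ => y) (by simp only [eval, push, add_zero'])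
    (fun x hx => by simp only [eval, push] at hx ⊢; rw [add_succ', hx, add_succ']) x

theorem add_comm' (y x : M.N) : y + x = x + y :=
  induct_eq (.add (.var 1) (.var 0)) (.add (.var 0) (.var 1)) (someFns M)
    (fun _ => y) (by simp only [eval, push, add_zero', zero_add'])
    (fun x hx => by simp only [eval, push] at hx ⊢; rw [add_succ', hx, succ_add']) x

theorem add_assoc' (y z x : M.N) : y + z + x = y + (z + x) :=
  induct_eq (.add (.add (.var 1) (.var 2)) (.var 0)) (.add (.var 1) (.add (.var 2) (.var 0)))
    (someFns M) (push y fun _ => z) (by simp only [eval, push, add_zero'])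
    (fun x hx => by simp only [eval, push] at hx ⊢; simp only [add_succ', hx]) x

theorem zero_mul' (x : M.N) : 0 * x = 0 :=
  induct_eq (.mul .zero (.var 0)) .zero (someFns M) (fun _ => 0) (mul_zero' _)
    (fun x hx => by simp only [eval, push] at hx ⊢; rw [mul_succ', hx, add_zero']) x

theorem succ_mul' (y x : M.N) : M.succ y * x = y * x + x :=
  induct_eq (.mul (.succ (.var 1)) (.var 0)) (.add (.mul (.var 1) (.var 0)) (.var 0)) (someFns M)
    (fun _ => y) (by simp only [eval, push, add_zero', mul_zero'])
    (fun x hx => by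
      simp only [eval, push] at hx ⊢
      simp only [mul_succ', hx, add_succ', add_assoc', add_comm' x y]) x

theorem mul_comm' (y x : M.N) : y * x = x * y :=
  induct_eq (.mul (.var 1) (.var 0)) (.mul (.var 0) (.var 1)) (someFns M)
    (fun _ => y) (by simp only [eval, push, mul_zero', zero_mul'])
    (fun x hx => by simp only [eval, push] at hx ⊢; rw [mul_succ', hx, succ_mul']) x

theorem mul_add' (y z x : M.N) : y * (z + x) = y * z + y * x :=
  induct_eq (.mul (.var 1) (.add (.var 2) (.var 0)))
    (.add (.mul (.var 1) (.var 2)) (.mul (.var 1) (.var 0)))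
    (someFns M) (push y fun _ => z) (by simp only [eval, push, add_zero', mul_zero'])
    (fun x hx => by
      simp only [eval, push] at hx ⊢; rw [add_succ', mul_succ', hx, mul_succ', add_assoc']) x

theorem mul_assoc' (y z x : M.N) : y * z * x = y * (z * x) :=
  induct_eq (.mul (.mul (.var 1) (.var 2)) (.var 0)) (.mul (.var 1) (.mul (.var 2) (.var 0)))
    (someFns M) (push y fun _ => z) (by simp only [eval, push, mul_zero'])
    (fun x hx => by
      simp only [eval, push] at hx ⊢; rw [mul_succ', hx, mul_succ', mul_add']) x

instance : One M.N := ⟨M.succ 0⟩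

theorem one_def : (1 : M.N) = M.succ 0 := rfl

instance : CommSemiring M.N where
  add_assoc := add_assoc'
  zero_add := zero_add'
  add_zero := add_zero'
  add_comm := add_comm'
  nsmul := nsmulRec
  left_distrib := mul_add'
  right_distrib a b c := by rw [mul_comm', mul_add', mul_comm' c, mul_comm' c]
  zero_mul := zero_mul'
  mul_zero := mul_zero'
  mul_assoc := mul_assoc'
  one_mul a := by rw [one_def, succ_mul', zero_mul', zero_add']
  mul_one a := by rw [one_def, mul_succ', mul_zero', zero_add']
  mul_comm := mul_comm'

theorem succ_eq (x : M.N) : M.succ x = x + 1 := by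
  rw [one_def, add_succ', add_zero']

theorem add_one_ne_zero' (x : M.N) : x + 1 ≠ 0 := by
  rw [← succ_eq]; exact hM.out.succ_ne_zero x

/-! ### Predecessor and truncated subtraction -/

/-- The term for the predecessor. -/
def predT (t : ArithTerm) : ArithTerm := .prec .zero (.var 1) t

/-- The term for truncated subtraction. -/
def subT (s t : ArithTerm) : ArithTerm := .prec s (predT (.var 0)) t

def pred (x : M.N) : M.N := M.recur 0 (fun _ k => k) x

/-- Truncated subtraction. -/
def tsub (x y : M.N) : M.N := M.recur x (fun a _ => pred a) y

@[simp] theorem eval_predT (g : ℕ → M.Fn) (e : ℕ → M.N) (t : ArithTerm) :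
    M.eval g e (predT t) = pred (M.eval g e t) := rfl

@[simp] theorem eval_subT (g : ℕ → M.Fn) (e : ℕ → M.N) (s t : ArithTerm) :
    M.eval g e (subT s t) = tsub (M.eval g e s) (M.eval g e t) := rfl

@[simp] theorem pred_zero : pred (0 : M.N) = 0 :=
  hM.out.recur_zero (.var 1) (someFns M) (fun _ => 0) 0

@[simp] theorem pred_add_one (x : M.N) : pred (x + 1) = x := by
  rw [← succ_eq]; exact hM.out.recur_succ (.var 1) (someFns M) (fun _ => 0) 0 x

@[simp] theorem tsub_zero (x : M.N) : tsub x 0 = x :=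
  hM.out.recur_zero (predT (.var 0)) (someFns M) (fun _ => 0) x

@[simp] theorem tsub_add_one (x y : M.N) : tsub x (y + 1) = pred (tsub x y) := by
  rw [← succ_eq]; exact hM.out.recur_succ (predT (.var 0)) (someFns M) (fun _ => 0) x y

/-- The existential is not quantifier-free, so the induction uses the predecessor term as an
explicit witness. -/
theorem eq_zero_or_eq_add_one (x : M.N) : x = 0 ∨ ∃ y, x = y + 1 := by
  have := hM.out.qf_induction (.or (.eq (.var 0) .zero) (.eq (.var 0) (.succ (predT (.var 0)))))
    ⟨trivial, trivial⟩ (someFns M) (fun _ => 0) (.inl rfl)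
    (fun x _ => .inr (by simp only [Sat, eval, eval_predT, push, succ_eq, pred_add_one])) x
  simp only [Sat, eval, eval_predT, push, succ_eq] at this
  exact this.imp_right fun h => ⟨_, h⟩

theorem add_right_cancel' (x y z : M.N) (hxy : x + z = y + z) : x = y := by
  have := hM.out.qf_induction (.imp (.eq (.add (.var 1) (.var 0)) (.add (.var 2) (.var 0)))
    (.eq (.var 1) (.var 2))) ⟨trivial, trivial⟩ (someFns M) (push x fun _ => y)
    (by simp [Sat, eval, push])
    (fun z ih hz => ih (by
      simp only [Sat, eval, push, add_succ'] at hz ⊢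
      exact hM.out.succ_inj _ _ hz)) z
  exact this hxy

instance : IsCancelAdd M.N :=
  have : IsRightCancelAdd M.N := ⟨fun z x y => add_right_cancel' x y z⟩
  AddCommMagma.IsRightCancelAdd.toIsCancelAdd _

theorem tsub_succ_succ (x y : M.N) : tsub (x + 1) (y + 1) = tsub x y := by
  have := induct_eq (subT (.succ (.var 1)) (.succ (.var 0))) (subT (.var 1) (.var 0))
    (someFns M) (fun _ => x)
    (by simp only [eval_subT, eval, push, succ_eq, tsub_add_one, tsub_zero, pred_add_one])
    (fun y hy => by
      simp only [eval_subT, eval, push, succ_eq] at hy ⊢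
      rw [tsub_add_one, hy, tsub_add_one]) y
  simpa only [eval_subT, eval, push, succ_eq] using this

@[simp] theorem add_tsub_cancel (x y : M.N) : tsub (x + y) y = x := by
  refine induct_eq (subT (.add (.var 1) (.var 0)) (.var 0)) (.var 1) (someFns M) (fun _ => x)
    (by simp [eval, push]) (fun y hy => ?_) y
  simp only [eval_subT, eval, push, succ_eq, ← add_assoc, tsub_succ_succ] at hy ⊢
  exact hy

theorem zero_tsub (x : M.N) : tsub 0 x = 0 := by
  refine induct_eq (subT .zero (.var 0)) .zero (someFns M) (fun _ => x)
    (by simp [eval, push]) (fun y hy => ?_) x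
  simp only [eval_subT, eval, push, succ_eq] at hy ⊢
  rw [tsub_add_one, hy, pred_zero]

theorem tsub_add_self (x y : M.N) : tsub x (x + y) = 0 := by
  refine induct_eq (subT (.var 0) (.add (.var 0) (.var 1))) .zero (someFns M) (fun _ => y)
    (by simp [eval, push, zero_tsub]) (fun x hx => ?_) x
  simp only [eval_subT, eval, push, succ_eq, add_right_comm, tsub_succ_succ] at hx ⊢
  exact hx

/-! ### Order -/

/-- `M.le` hides an existential; truncated subtraction supplies the witness, which makes the
induction formula quantifier-free. -/
theorem le_total' (x y : M.N) : M.le x y ∨ M.le y x := by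
  have := hM.out.qf_induction (.or (.eq (.add (.var 1) (subT (.var 0) (.var 1))) (.var 0))
    (.eq (.add (.var 0) (subT (.var 1) (.var 0))) (.var 1)))
    ⟨trivial, trivial⟩ (someFns M) (fun _ => y) (.inr (by simp [Sat, eval, push]))
    (fun x hx => by
      simp only [Sat, eval_subT, eval, push, succ_eq] at hx ⊢
      rcases hx with hx | hx
      · left
        generalize tsub x y = c at hx
        subst hx
        rw [show y + c + 1 = c + 1 + y by ring, add_tsub_cancel, add_comm]
      · generalize hc : tsub y x = c at hx
        subst hx
        -- For `c = 0` the two numbers agree, and the successor step moves to the other disjunct.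
        rcases eq_zero_or_eq_add_one c with rfl | ⟨d, rfl⟩
        · left
          rw [add_zero, add_comm x 1, add_tsub_cancel, add_comm]
        · right
          rw [show x + (d + 1) = d + (x + 1) by ring, add_tsub_cancel]; ring) x
  simp only [Sat, eval_subT, eval, push] at this
  rcases this with h | h
  exacts [.inr ⟨_, h⟩, .inl ⟨_, h⟩]

theorem eq_zero_of_add_eq_zero {x y : M.N} (h : x + y = 0) : y = 0 := by
  rcases eq_zero_or_eq_add_one y with rfl | ⟨z, rfl⟩
  · rfl
  · rw [← add_assoc] at h
    exact absurd h (add_one_ne_zero' _)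

noncomputable instance : LinearOrder M.N where
  le := M.le
  le_refl x := ⟨0, add_zero x⟩
  le_trans := by
    rintro x _ _ ⟨a, rfl⟩ ⟨b, rfl⟩
    exact ⟨a + b, by ring⟩
  le_antisymm := by
    rintro x _ ⟨a, rfl⟩ ⟨b, hb⟩
    have : b = 0 := eq_zero_of_add_eq_zero (x := a) (add_left_cancel (a := x) (by rw [← add_assoc, hb, add_zero]))
    rw [this, add_zero] at hb
    exact hb.symm
  le_total := le_total'
  toDecidableLE := Classical.decRel _

theorem le_iff_le (x y : M.N) : M.le x y ↔ x ≤ y := Iff.rfl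

theorem lt_iff_add_one_le {x y : M.N} : x < y ↔ x + 1 ≤ y := by
  constructor
  · intro h
    obtain ⟨c, rfl⟩ := h.le
    rcases eq_zero_or_eq_add_one c with rfl | ⟨d, rfl⟩
    · simp at h
    · exact ⟨d, by ring⟩
  · rintro ⟨c, rfl⟩
    refine lt_of_le_of_ne ⟨1 + c, by ring⟩ fun h => add_one_ne_zero' c ?_
    refine add_left_cancel (a := x) ?_
    rw [add_zero]
    conv_rhs => rw [h]
    ring

instance : CanonicallyOrderedAdd M.N where
  exists_add_of_le := by rintro x _ ⟨c, rfl⟩; exact ⟨c, rfl⟩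
  le_self_add x y := ⟨y, rfl⟩
  le_add_self x y := ⟨y, add_comm _ _⟩

instance : Nontrivial M.N := ⟨0, 1, (by simpa using (add_one_ne_zero' (0 : M.N)).symm)⟩

instance : IsOrderedAddMonoid M.N where
  add_le_add_left := by
    rintro x _ ⟨c, rfl⟩ z
    exact ⟨c, by ring⟩

instance : IsOrderedCancelAddMonoid M.N where
  le_of_add_le_add_left := by
    rintro x y z ⟨c, hc⟩
    exact ⟨c, add_left_cancel (a := x) (by rw [← add_assoc, hc])⟩

theorem mul_lt_mul_of_pos_left' {a b c : M.N} (hc : 0 < c) (hab : a < b) : c * a < c * b := by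
  rw [lt_iff_add_one_le] at *
  obtain ⟨d, rfl⟩ := hab
  obtain ⟨e, rfl⟩ := hc
  exact ⟨d + e + e * d, by ring⟩

instance : IsStrictOrderedRing M.N where
  zero_le_one := zero_le
  mul_lt_mul_of_pos_left c hc a b hab := mul_lt_mul_of_pos_left' hc hab
  mul_lt_mul_of_pos_right c hc a b hab := by
    rw [mul_comm a, mul_comm b]; exact mul_lt_mul_of_pos_left' hc hab

theorem tsub_eq_zero_iff {x y : M.N} : tsub x y = 0 ↔ x ≤ y := by
  constructor
  · intro h
    rcases le_total x y with h' | ⟨c, rfl⟩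
    · exact h'
    · rw [add_comm, add_tsub_cancel] at h
      simp [h]
  · rintro ⟨c, rfl⟩
    exact tsub_add_self x c

end Arithmetic
end ArithStructure

/-! ### Functions of the model, decidable predicates, and the reduction to `Σ⁰₁` comprehension. -/

namespace ArithStructure

variable {M : ArithStructure.{u}}

section Functions

variable [hM : Fact M.IsModelRCA0] {f f₁ f₂ f₃ : M.N → M.N}

/-! ### Closure properties of the functions of a model -/

theorem mem_id : (fun x : M.N => x) ∈ M.Fn :=
  hM.out.abstraction (.var 0) (someFns M) (fun _ => 0)

theorem mem_const (c : M.N) : (fun _ : M.N => c) ∈ M.Fn :=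
  hM.out.abstraction (.var 1) (someFns M) (fun _ => c)

/-- Abstraction is available for terms only; given functions enter as function parameters. With such
closure rules, later membership proofs mostly avoid syntax. -/
theorem mem_comp (hf : f ∈ M.Fn) (hf₁ : f₁ ∈ M.Fn) : (fun x => f (f₁ x)) ∈ M.Fn :=
  hM.out.abstraction (.app 0 (.app 1 (.var 0))) (push ⟨f, hf⟩ fun _ => ⟨f₁, hf₁⟩) (fun _ => 0)

theorem mem_add (hf : f₁ ∈ M.Fn) (hf₁ : f₂ ∈ M.Fn) : (fun x => f₁ x + f₂ x) ∈ M.Fn :=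
  hM.out.abstraction (.add (.app 0 (.var 0)) (.app 1 (.var 0)))
    (push ⟨f₁, hf⟩ fun _ => ⟨f₂, hf₁⟩) (fun _ => 0)

theorem mem_mul (hf : f₁ ∈ M.Fn) (hf₁ : f₂ ∈ M.Fn) : (fun x => f₁ x * f₂ x) ∈ M.Fn :=
  hM.out.abstraction (.mul (.app 0 (.var 0)) (.app 1 (.var 0)))
    (push ⟨f₁, hf⟩ fun _ => ⟨f₂, hf₁⟩) (fun _ => 0)

theorem mem_tsub (hf : f₁ ∈ M.Fn) (hf₁ : f₂ ∈ M.Fn) : (fun x => tsub (f₁ x) (f₂ x)) ∈ M.Fn :=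
  hM.out.abstraction (subT (.app 0 (.var 0)) (.app 1 (.var 0)))
    (push ⟨f₁, hf⟩ fun _ => ⟨f₂, hf₁⟩) (fun _ => 0)

theorem mem_pair (hf : f₁ ∈ M.Fn) (hf₁ : f₂ ∈ M.Fn) : (fun x => M.pair (f₁ x) (f₂ x)) ∈ M.Fn :=
  mem_add (mem_mul (mem_add hf hf₁) (mem_add hf hf₁)) hf

theorem one_le_iff_ne_zero' {x : M.N} : 1 ≤ x ↔ x ≠ 0 := by
  rw [← zero_add (1 : M.N), ← lt_iff_add_one_le, pos_iff_ne_zero]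

/-- Predicates with a characteristic function in the model. -/
def Decid (P : M.N → Prop) : Prop := ∃ f ∈ M.Fn, ∀ x, P x ↔ f x = 0

theorem Decid.of_le (hf : f₁ ∈ M.Fn) (hf₁ : f₂ ∈ M.Fn) : Decid fun x => f₁ x ≤ f₂ x :=
  ⟨_, mem_tsub hf hf₁, fun _ => tsub_eq_zero_iff.symm⟩

theorem Decid.and {P Q : M.N → Prop} (hP : Decid P) (hQ : Decid Q) : Decid fun x => P x ∧ Q x := by
  obtain ⟨f, hf, hfP⟩ := hP
  obtain ⟨f', hf', hfQ⟩ := hQ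
  exact ⟨_, mem_add hf hf', fun x => by simp only [hfP, hfQ, add_eq_zero]⟩

theorem Decid.or {P Q : M.N → Prop} (hP : Decid P) (hQ : Decid Q) : Decid fun x => P x ∨ Q x := by
  obtain ⟨f, hf, hfP⟩ := hP
  obtain ⟨f', hf', hfQ⟩ := hQ
  exact ⟨_, mem_mul hf hf', fun x => by simp only [hfP, hfQ, mul_eq_zero]⟩

theorem Decid.not {P : M.N → Prop} (hP : Decid P) : Decid fun x => ¬ P x := by
  obtain ⟨f, hf, hfP⟩ := hP
  refine ⟨_, mem_tsub (mem_const 1) hf, fun x => ?_⟩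
  simp only [hfP, tsub_eq_zero_iff, one_le_iff_ne_zero', Ne]

theorem Decid.imp {P Q : M.N → Prop} (hP : Decid P) (hQ : Decid Q) : Decid fun x => P x → Q x := by
  simpa only [imp_iff_not_or] using hP.not.or hQ

theorem Decid.of_eq (hf : f₁ ∈ M.Fn) (hf₁ : f₂ ∈ M.Fn) : Decid fun x => f₁ x = f₂ x := by
  simpa only [le_antisymm_iff] using (Decid.of_le hf hf₁).and (Decid.of_le hf₁ hf)

theorem Decid.of_lt (hf : f₁ ∈ M.Fn) (hf₁ : f₂ ∈ M.Fn) : Decid fun x => f₁ x < f₂ x := by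
  simpa only [not_le] using (Decid.of_le hf₁ hf).not

theorem Decid.comp {P : M.N → Prop} (hP : Decid P) (hf : f ∈ M.Fn) : Decid fun x => P (f x) := by
  obtain ⟨f', hf', hfP⟩ := hP
  exact ⟨_, mem_comp hf' hf, fun x => hfP _⟩

theorem Decid.exists_char {P : M.N → Prop} (hP : Decid P) :
    ∃ χ ∈ M.Fn, ∀ x, (P x → χ x = 1) ∧ (¬ P x → χ x = 0) := by
  obtain ⟨f, hf, hfP⟩ := hP
  refine ⟨_, mem_tsub (mem_const 1) hf, fun x => ⟨fun h => ?_, fun h => ?_⟩⟩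
  · rw [(hfP x).1 h, tsub_zero]
  · rwa [tsub_eq_zero_iff, one_le_iff_ne_zero', Ne, ← hfP]

/-- A predicate with a characteristic function `f` is the atomic formula `f x = 0` with `f` as a
parameter, so quantifier-free induction covers it. -/
theorem Decid.induct {P : M.N → Prop} (hP : Decid P) (h0 : P 0) (hs : ∀ x, P x → P (x + 1))
    (x : M.N) : P x := by
  obtain ⟨f, hf, hfP⟩ := hP
  simp only [hfP] at *
  exact induct_eq (.app 0 (.var 0)) .zero (fun _ => ⟨f, hf⟩) (fun _ => 0) h0
    (fun x hx => by rw [succ_eq]; exact hs x hx) x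

/-! ### Pairing -/

/-- The integer square root. -/
def sqrt (x : M.N) : M.N :=
  M.recur 0 (fun a k => a + tsub (M.succ 0) (tsub (M.succ a * M.succ a) (M.succ k))) x

theorem mem_sqrt : (fun x : M.N => sqrt x) ∈ M.Fn :=
  hM.out.abstraction (.prec .zero (.add (.var 0) (subT (.succ .zero)
    (subT (.mul (.succ (.var 0)) (.succ (.var 0))) (.succ (.var 1))))) (.var 0))
    (someFns M) (fun _ => 0)

theorem sqrt_zero : sqrt (0 : M.N) = 0 :=
  hM.out.recur_zero (.add (.var 0) (subT (.succ .zero)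
    (subT (.mul (.succ (.var 0)) (.succ (.var 0))) (.succ (.var 1)))))
    (someFns M) (fun _ => 0) 0

theorem sqrt_add_one (x : M.N) :
    sqrt (x + 1) = sqrt x + tsub 1 (tsub ((sqrt x + 1) * (sqrt x + 1)) (x + 1)) := by
  have := hM.out.recur_succ (.add (.var 0) (subT (.succ .zero)
    (subT (.mul (.succ (.var 0)) (.succ (.var 0))) (.succ (.var 1)))))
    (someFns M) (fun _ => 0) 0 x
  simp only [← succ_eq]
  exact this

theorem sqrt_spec (x : M.N) :
    sqrt x * sqrt x ≤ x ∧ x < (sqrt x + 1) * (sqrt x + 1) := by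
  have hs : (fun x : M.N => sqrt x + 1) ∈ M.Fn := mem_add mem_sqrt (mem_const 1)
  refine Decid.induct (P := fun x : M.N => sqrt x * sqrt x ≤ x ∧ x < (sqrt x + 1) * (sqrt x + 1))
    ((Decid.of_le (mem_mul mem_sqrt mem_sqrt) mem_id).and (Decid.of_lt mem_id (mem_mul hs hs)))
    ?_ ?_ x
  · simp [sqrt_zero]
  · rintro x ⟨h₁, h₂⟩
    rw [sqrt_add_one]
    -- The nested truncated subtraction is `1` if the next square has been reached and `0`
    -- otherwise.
    rcases le_or_gt ((sqrt x + 1) * (sqrt x + 1)) (x + 1) with h | h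
    · rw [tsub_eq_zero_iff.2 h, tsub_zero]
      refine ⟨h, ?_⟩
      obtain ⟨c, hc⟩ := lt_iff_add_one_le.1 h₂
      rw [lt_iff_add_one_le]
      refine (add_le_add_left (le_self_add.trans hc.le) 1).trans ?_
      exact ⟨2 * (sqrt x + 1), by ring⟩
    · rw [tsub_eq_zero_iff.2, add_zero]
      · exact ⟨h₁.trans le_self_add, h⟩
      · rw [one_le_iff_ne_zero', Ne, tsub_eq_zero_iff]
        exact not_le.2 h

theorem sqrt_eq {x s : M.N} (h₁ : s * s ≤ x) (h₂ : x < (s + 1) * (s + 1)) : sqrt x = s := by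
  have aux : ∀ {a b : M.N}, a * a ≤ x → x < (b + 1) * (b + 1) → a ≤ b := by
    intro a b ha hb
    by_contra h
    rw [not_le, lt_iff_add_one_le] at h
    exact absurd (ha.trans_lt hb) (not_lt.2 (mul_le_mul' h h))
  exact le_antisymm (aux (sqrt_spec x).1 h₂) (aux h₁ (sqrt_spec x).2)

/-- The first component of a pair. -/
def fst (x : M.N) : M.N := tsub x (sqrt x * sqrt x)

/-- The second component of a pair. -/
def snd (x : M.N) : M.N := tsub (sqrt x) (fst x)

theorem mem_fst : (fun x : M.N => fst x) ∈ M.Fn := mem_tsub mem_id (mem_mul mem_sqrt mem_sqrt)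

theorem mem_snd : (fun x : M.N => snd x) ∈ M.Fn := mem_tsub mem_sqrt mem_fst

/-- The code `(i + k)² + i` lies below the next square, so its root recovers `i + k` and the excess
recovers `i`. -/
theorem sqrt_pair (i k : M.N) : sqrt (M.pair i k) = i + k :=
  sqrt_eq le_self_add (lt_iff_add_one_le.2 ⟨i + 2 * k, by rw [pair]; ring⟩)

@[simp] theorem fst_pair (i k : M.N) : fst (M.pair i k) = i := by
  rw [fst, sqrt_pair, pair, add_comm, add_tsub_cancel]

@[simp] theorem snd_pair (i k : M.N) : snd (M.pair i k) = k := by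
  rw [snd, sqrt_pair, fst_pair, add_comm, add_tsub_cancel]

/-! ### Primitive recursion -/

/-- The step is one function of the code of previous value, stage and parameter: the shape that
`mem_eval` produces when the two variables bound by `prec` are absorbed into the code. -/
theorem mem_recur (hb : f₁ ∈ M.Fn) (hs : f₂ ∈ M.Fn) (hn : f₃ ∈ M.Fn) :
    (fun z => M.recur (f₁ z) (fun a k => f₂ (M.pair a (M.pair k z))) (f₃ z)) ∈ M.Fn := by
  let p (s t : ArithTerm) : ArithTerm := .add (.mul (.add s t) (.add s t)) s
  exact hM.out.abstraction (.prec (.app 0 (.var 0)) (.app 1 (p (.var 0) (p (.var 1) (.var 2))))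
    (.app 2 (.var 0))) (push ⟨f₁, hb⟩ (push ⟨f₂, hs⟩ fun _ => ⟨f₃, hn⟩)) (fun _ => 0)

/-- Primitive recursion with a parameter. -/
theorem exists_mem_recur {b s : M.N → M.N} (hb : b ∈ M.Fn) (hs : s ∈ M.Fn) :
    ∃ r ∈ M.Fn, (∀ i, r (M.pair i 0) = b i) ∧
      ∀ i k, r (M.pair i (k + 1)) = s (M.pair (r (M.pair i k)) (M.pair i k)) := by
  let p (s t : ArithTerm) : ArithTerm := .add (.mul (.add s t) (.add s t)) s
  let g : ℕ → M.Fn := push ⟨b, hb⟩ (push ⟨s, hs⟩ (push ⟨_, mem_fst⟩ fun _ => ⟨_, mem_snd⟩))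
  let st (z a k : M.N) : M.N := s (M.pair a (M.pair (fst z) k))
  let t : ArithTerm := .app 1 (p (.var 0) (p (.app 2 (.var 2)) (.var 1)))
  have hr : (fun z => M.recur (b (fst z)) (st z) (snd z)) ∈ M.Fn :=
    hM.out.abstraction (.prec (.app 0 (.app 2 (.var 0))) t (.app 3 (.var 0))) g (fun _ => 0)
  have h0 (z c : M.N) : M.recur c (st z) 0 = c :=
    hM.out.recur_zero t g (push z fun _ => 0) c
  have h1 (z c k : M.N) : M.recur c (st z) (M.succ k) = st z (M.recur c (st z) k) k :=
    hM.out.recur_succ t g (push z fun _ => 0) c k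
  -- The argument changes from `M.pair i k` to `M.pair i (k + 1)`, but the step reads only its first
  -- component, so both values come from the same recursion.
  have hst (i k l : M.N) : st (M.pair i k) = st (M.pair i l) := by simp only [st, fst_pair]
  refine ⟨_, hr, fun i => ?_, fun i k => ?_⟩
  · simp only [fst_pair, snd_pair, h0]
  · simp only [fst_pair, snd_pair, ← succ_eq, h1, hst i (M.succ k) k]
    simp only [st, fst_pair]

theorem pow2_zero : M.pow2 0 = 1 :=
  hM.out.recur_zero (.add (.var 0) (.var 0)) (someFns M) (fun _ => 0) 1

theorem pow2_add_one (k : M.N) : M.pow2 (k + 1) = M.pow2 k + M.pow2 k := by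
  rw [← succ_eq]
  exact hM.out.recur_succ (.add (.var 0) (.var 0)) (someFns M) (fun _ => 0) 1 k

theorem mem_pow2 : (fun x => M.pow2 x) ∈ M.Fn :=
  hM.out.abstraction (.prec (.succ .zero) (.add (.var 0) (.var 0)) (.var 0)) (someFns M)
    (fun _ => 0)

theorem add_one_le_pow2 (k : M.N) : k + 1 ≤ M.pow2 k := by
  refine Decid.induct (P := fun k : M.N => k + 1 ≤ M.pow2 k)
    (Decid.of_le (mem_add mem_id (mem_const 1)) mem_pow2) ?_ ?_ k
  · simp [pow2_zero]
  · intro k hk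
    rw [pow2_add_one]
    exact add_le_add hk (le_add_self.trans hk)

/-! ### From `Σ⁰₁` to arithmetical comprehension -/

/-- Replace the first `n` values of `e` by the entries of the tuple coded by `z`. -/
def decode (e : ℕ → M.N) : ℕ → M.N → ℕ → M.N
  | 0, _ => e
  | n + 1, z => push (fst z) (decode e n (snd z))

theorem push_decode (e : ℕ → M.N) (n : ℕ) (a z : M.N) :
    push a (decode e n z) = decode e (n + 1) (M.pair a z) := by
  rw [decode, fst_pair, snd_pair]

theorem mem_decode (e : ℕ → M.N) (n i : ℕ) : (fun z => decode e n z i) ∈ M.Fn := by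
  induction n generalizing i with
  | zero => exact mem_const (e i)
  | succ n ih =>
    cases i with
    | zero => exact mem_fst
    | succ i => exact mem_comp (ih i) mem_snd

/-- Finitely many number variables are packed into the single argument `z`. The count `n` must vary
because passing under `prec` adds two variables. -/
theorem mem_eval (g : ℕ → M.Fn) (e : ℕ → M.N) (t : ArithTerm) (n : ℕ) :
    (fun z => M.eval g (decode e n z) t) ∈ M.Fn := by
  induction t generalizing n with
  | var i => exact mem_decode e n i
  | zero => exact mem_const 0
  | succ t ih => simpa only [eval, succ_eq] using mem_add (ih n) (mem_const 1)
  | add s t ihs iht => exact mem_add (ihs n) (iht n)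
  | mul s t ihs iht => exact mem_mul (ihs n) (iht n)
  | app f t ih => exact mem_comp (g f).2 (ih n)
  | prec b s k ihb ihs ihk =>
    simpa only [eval, push_decode] using mem_recur (ihb n) (ihs (n + 2)) (ihk n)

variable (M) in
/-- Comprehension for `Σ⁰₁` predicates. -/
def SigmaComprehension : Prop :=
  ∀ f ∈ M.Fn, Decid fun i => ∃ k, f (M.pair i k) = 0

/-- The matrix of an existential formula has a characteristic function by induction, so the formula
is `Σ⁰₁` relative to a function of the model; universal quantifiers are read as `¬∃¬`. -/
theorem SigmaComprehension.decid_sat (hS : M.SigmaComprehension) (g : ℕ → M.Fn) (e : ℕ → M.N)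
    (A : ArithFormula) (hA : A.IsArithmetical) (n : ℕ) :
    Decid fun z => M.Sat g (decode e n z) A := by
  have hex (P : M.N → Prop) (hP : Decid P) : Decid fun z => ∃ x, P (M.pair x z) := by
    obtain ⟨f, hf, hfP⟩ := hP
    have := hS _ (mem_comp hf (mem_pair mem_snd mem_fst))
    simpa only [hfP, fst_pair, snd_pair] using this
  induction A generalizing n with
  | eq s t => exact Decid.of_eq (mem_eval g e s n) (mem_eval g e t n)
  | falsum => exact ⟨_, mem_const 1, fun _ => by simp [Sat]⟩
  | and A B ihA ihB => exact (ihA hA.1 n).and (ihB hA.2 n)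
  | or A B ihA ihB => exact (ihA hA.1 n).or (ihB hA.2 n)
  | imp A B ihA ihB => exact (ihA hA.1 n).imp (ihB hA.2 n)
  | all A ih =>
    have := (hex _ (ih hA (n + 1)).not).not
    simpa only [Sat, not_exists, not_not, ← push_decode] using this
  | ex A ih => simpa only [Sat, ← push_decode] using hex _ (ih hA (n + 1))
  | allFun A => exact hA.elim
  | exFun A => exact hA.elim

theorem SigmaComprehension.arithmeticalComprehension (hS : M.SigmaComprehension) :
    M.ArithmeticalComprehension := by
  intro A hA g e
  -- One variable is decoded, so the tail of the code is irrelevant and `0` fills it.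
  have := ((hS.decid_sat g e A hA 1).comp (mem_pair mem_id (mem_const 0))).exists_char
  obtain ⟨χ, hχ, h⟩ := this
  simp only [decode, fst_pair] at h
  exact ⟨⟨χ, hχ⟩, h⟩

end Functions
end ArithStructure

/-! ### The ordered field of rationals of the model. -/

namespace ArithStructure

variable {M : ArithStructure.{u}}

section RatField

set_option linter.unusedSectionVars false

variable [hM : Fact M.IsModelRCA0]

/-! ### The ordered field of rational numbers of a model -/

namespace Frac

theorem zero_def : (0 : Frac M) = ⟨0, 0, 0⟩ := rfl
theorem one_def : (1 : Frac M) = ⟨1, 0, 0⟩ := rfl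

theorem add_def (p q : Frac M) : p + q = ⟨p.pos * (q.den + 1) + q.pos * (p.den + 1),
    p.neg * (q.den + 1) + q.neg * (p.den + 1), p.den * q.den + p.den + q.den⟩ := by
  simp only [← succ_eq]; rfl

theorem neg_def (p : Frac M) : -p = ⟨p.neg, p.pos, p.den⟩ := rfl

theorem sub_def (p q : Frac M) : p - q = p + -q := rfl

theorem mul_def (p q : Frac M) : p * q = ⟨p.pos * q.pos + p.neg * q.neg,
    p.pos * q.neg + p.neg * q.pos, p.den * q.den + p.den + q.den⟩ := rfl

/-- The order of the represented rational numbers. -/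
instance : Preorder (Frac M) where
  le p q := p.pos * (q.den + 1) + q.neg * (p.den + 1) ≤ q.pos * (p.den + 1) + p.neg * (q.den + 1)
  le_refl p := le_rfl
  le_trans p q r hpq hqr := by
    have h1 := mul_le_mul_of_nonneg_left hpq (zero_le (a := r.den + 1))
    have h2 := mul_le_mul_of_nonneg_left hqr (zero_le (a := p.den + 1))
    -- `M.N` is only a semiring: the middle fraction is removed by cancelling its denominator and
    -- then its two numerator parts.
    refine le_of_mul_le_mul_left (a := q.den + 1) ?_ (zero_lt_one.trans_le le_add_self)
    refine le_of_add_le_add_left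
      (a := (p.den + 1) * (r.den + 1) * (q.pos + q.neg)) ?_
    convert! add_le_add h1 h2 using 1 <;> ring

theorem le_def {p q : Frac M} : p ≤ q ↔
    p.pos * (q.den + 1) + q.neg * (p.den + 1) ≤ q.pos * (p.den + 1) + p.neg * (q.den + 1) :=
  Iff.rfl

noncomputable instance : DecidableLE (Frac M) := Classical.decRel _
noncomputable instance : DecidableLT (Frac M) := Classical.decRel _

instance : @Std.Total (Frac M) (· ≤ ·) where
  total p q := by
    rw [le_def, le_def, add_comm (q.pos * _), add_comm (p.pos * _)]
    rw [add_comm (q.neg * _)]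
    exact le_total _ _

theorem antisymmRel_iff {p q : Frac M} : AntisymmRel (· ≤ ·) p q ↔
    p.pos * (q.den + 1) + q.neg * (p.den + 1) = q.pos * (p.den + 1) + p.neg * (q.den + 1) := by
  rw [AntisymmRel, le_def, le_def, le_antisymm_iff]

theorem antisymmRel_add {p p' q q' : Frac M} (h : AntisymmRel (· ≤ ·) p p')
    (h' : AntisymmRel (· ≤ ·) q q') : AntisymmRel (· ≤ ·) (p + q) (p' + q') := by
  rw [antisymmRel_iff] at *
  simp only [add_def]
  linear_combination (q.den + 1) * (q'.den + 1) * h + (p.den + 1) * (p'.den + 1) * h'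

theorem antisymmRel_neg {p p' : Frac M} (h : AntisymmRel (· ≤ ·) p p') :
    AntisymmRel (· ≤ ·) (-p) (-p') := by
  rw [antisymmRel_iff] at *
  simp only [neg_def]
  linear_combination -h

theorem antisymmRel_mul {p p' q q' : Frac M} (h : AntisymmRel (· ≤ ·) p p')
    (h' : AntisymmRel (· ≤ ·) q q') : AntisymmRel (· ≤ ·) (p * q) (p' * q') := by
  have aux {p p' : Frac M} (q : Frac M) (h : AntisymmRel (· ≤ ·) p p') :
      AntisymmRel (· ≤ ·) (p * q) (p' * q) := by
    rw [antisymmRel_iff] at *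
    simp only [mul_def]
    -- The negative part of `q` swaps the two sides, hence the reversed equation.
    linear_combination (q.den + 1) * q.pos * h + (q.den + 1) * q.neg * h.symm
  refine (aux q h).trans ?_
  have hc (a b : Frac M) : a * b = b * a := by
    simp only [mul_def]; ext <;> simp only <;> ring
  rw [hc, hc p']
  exact aux p' h'

end Frac

variable (M) in
/-- The rational numbers of a model. -/
def RatNum : Type u := Antisymmetrization (Frac M) (· ≤ ·)

namespace RatNum

noncomputable instance : LinearOrder (RatNum M) :=
  inferInstanceAs (LinearOrder (Antisymmetrization (Frac M) (· ≤ ·)))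

/-- The rational number with a given code. -/
def mk (p : Frac M) : RatNum M := toAntisymmetrization (· ≤ ·) p

theorem exists_mk (x : RatNum M) : ∃ p, mk p = x := Quotient.exists_rep x

theorem mk_le_mk {p q : Frac M} : mk p ≤ mk q ↔
    p.pos * (q.den + 1) + q.neg * (p.den + 1) ≤ q.pos * (p.den + 1) + p.neg * (q.den + 1) :=
  Iff.rfl

theorem mk_eq_mk {p q : Frac M} : mk p = mk q ↔
    p.pos * (q.den + 1) + q.neg * (p.den + 1) = q.pos * (p.den + 1) + p.neg * (q.den + 1) :=
  Quotient.eq''.trans Frac.antisymmRel_iff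

instance : Zero (RatNum M) := ⟨mk 0⟩
instance : One (RatNum M) := ⟨mk 1⟩
instance : Add (RatNum M) := ⟨Quotient.map₂ (· + ·) fun _ _ h _ _ h' => Frac.antisymmRel_add h h'⟩
instance : Mul (RatNum M) := ⟨Quotient.map₂ (· * ·) fun _ _ h _ _ h' => Frac.antisymmRel_mul h h'⟩
instance : Neg (RatNum M) := ⟨Quotient.map (- ·) fun _ _ h => Frac.antisymmRel_neg h⟩

theorem mk_zero : mk (0 : Frac M) = 0 := rfl
theorem mk_one : mk (1 : Frac M) = 1 := rfl
theorem mk_add (p q : Frac M) : mk (p + q) = mk p + mk q := rfl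
theorem mk_mul (p q : Frac M) : mk (p * q) = mk p * mk q := rfl
theorem mk_neg (p : Frac M) : mk (-p) = -mk p := rfl

noncomputable instance : CommRing (RatNum M) where
  add_assoc x y z := by
    obtain ⟨⟨p, rfl⟩, ⟨q, rfl⟩, ⟨r, rfl⟩⟩ := exists_mk x, exists_mk y, exists_mk z
    simp only [← mk_add, mk_eq_mk, Frac.add_def]; ring
  zero_add x := by
    obtain ⟨p, rfl⟩ := exists_mk x
    simp only [← mk_zero, ← mk_add, mk_eq_mk, Frac.add_def, Frac.zero_def]; ring
  add_zero x := by
    obtain ⟨p, rfl⟩ := exists_mk x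
    simp only [← mk_zero, ← mk_add, mk_eq_mk, Frac.add_def, Frac.zero_def]; ring
  add_comm x y := by
    obtain ⟨⟨p, rfl⟩, ⟨q, rfl⟩⟩ := exists_mk x, exists_mk y
    simp only [← mk_add, mk_eq_mk, Frac.add_def]; ring
  nsmul := nsmulRec
  zsmul := zsmulRec
  neg_add_cancel x := by
    obtain ⟨p, rfl⟩ := exists_mk x
    simp only [← mk_zero, ← mk_neg, ← mk_add, mk_eq_mk, Frac.add_def, Frac.zero_def,
      Frac.neg_def]; ring
  mul_assoc x y z := by
    obtain ⟨⟨p, rfl⟩, ⟨q, rfl⟩, ⟨r, rfl⟩⟩ := exists_mk x, exists_mk y, exists_mk z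
    simp only [← mk_mul, mk_eq_mk, Frac.mul_def]; ring
  mul_comm x y := by
    obtain ⟨⟨p, rfl⟩, ⟨q, rfl⟩⟩ := exists_mk x, exists_mk y
    simp only [← mk_mul, mk_eq_mk, Frac.mul_def]; ring
  one_mul x := by
    obtain ⟨p, rfl⟩ := exists_mk x
    simp only [← mk_one, ← mk_mul, mk_eq_mk, Frac.mul_def, Frac.one_def]; ring
  mul_one x := by
    obtain ⟨p, rfl⟩ := exists_mk x
    simp only [← mk_one, ← mk_mul, mk_eq_mk, Frac.mul_def, Frac.one_def]; ring
  zero_mul x := by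
    obtain ⟨p, rfl⟩ := exists_mk x
    simp only [← mk_zero, ← mk_mul, mk_eq_mk, Frac.mul_def, Frac.zero_def]; ring
  mul_zero x := by
    obtain ⟨p, rfl⟩ := exists_mk x
    simp only [← mk_zero, ← mk_mul, mk_eq_mk, Frac.mul_def, Frac.zero_def]; ring
  left_distrib x y z := by
    obtain ⟨⟨p, rfl⟩, ⟨q, rfl⟩, ⟨r, rfl⟩⟩ := exists_mk x, exists_mk y, exists_mk z
    simp only [← mk_mul, ← mk_add, mk_eq_mk, Frac.mul_def, Frac.add_def]; ring
  right_distrib x y z := by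
    obtain ⟨⟨p, rfl⟩, ⟨q, rfl⟩, ⟨r, rfl⟩⟩ := exists_mk x, exists_mk y, exists_mk z
    simp only [← mk_mul, ← mk_add, mk_eq_mk, Frac.mul_def, Frac.add_def]; ring

theorem mk_sub (p q : Frac M) : mk (p - q) = mk p - mk q := by
  rw [Frac.sub_def, mk_add, mk_neg, sub_eq_add_neg]

theorem mk_nonneg {p : Frac M} : 0 ≤ mk p ↔ p.neg ≤ p.pos := by
  rw [← mk_zero, mk_le_mk]; simp [Frac.zero_def]

theorem mk_pos {p : Frac M} : 0 < mk p ↔ p.neg < p.pos := by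
  rw [← not_le, ← mk_zero, mk_le_mk]; simp [Frac.zero_def]

instance : Nontrivial (RatNum M) :=
  ⟨0, 1, (mk_pos.2 (zero_lt_one : (0 : M.N) < 1)).ne⟩

instance : IsOrderedAddMonoid (RatNum M) where
  add_le_add_left x y h z := by
    obtain ⟨⟨p, rfl⟩, ⟨q, rfl⟩, ⟨r, rfl⟩⟩ := exists_mk x, exists_mk y, exists_mk z
    simp only [← mk_add, mk_le_mk, Frac.add_def] at *
    have h1 := mul_le_mul_of_nonneg_left h (zero_le (a := (r.den + 1) * (r.den + 1)))
    convert! add_le_add_right h1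
      ((p.den + 1) * (q.den + 1) * (r.den + 1) * (r.pos + r.neg)) using 1 <;> ring

instance : ZeroLEOneClass (RatNum M) := ⟨mk_nonneg.2 (zero_le (a := (1 : M.N)))⟩

instance : IsStrictOrderedRing (RatNum M) :=
  .of_mul_pos fun x y hx hy => by
    obtain ⟨⟨p, rfl⟩, ⟨q, rfl⟩⟩ := exists_mk x, exists_mk y
    rw [← mk_mul, mk_pos] at *
    obtain ⟨a, ha⟩ := lt_iff_add_one_le.1 hx
    obtain ⟨b, hb⟩ := lt_iff_add_one_le.1 hy
    rw [lt_iff_add_one_le]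
    -- The positive parts exceed the negative ones by `1 + a` and `1 + b`; for the product the
    -- excess is `(1 + a)(1 + b)`.
    refine ⟨a + b + a * b, ?_⟩
    simp only [Frac.mul_def, ← ha, ← hb]
    ring

theorem exists_mul_eq_one {x : RatNum M} (hx : x ≠ 0) : ∃ y, x * y = 1 := by
  have aux {x : RatNum M} (hx : 0 < x) : ∃ y, x * y = 1 := by
    obtain ⟨p, rfl⟩ := exists_mk x
    rw [mk_pos] at hx
    obtain ⟨a, ha⟩ := lt_iff_add_one_le.1 hx
    refine ⟨mk ⟨p.den + 1, 0, a⟩, ?_⟩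
    simp only [← mk_one, ← mk_mul, mk_eq_mk, Frac.mul_def, Frac.one_def, ← ha]
    ring
  rcases hx.lt_or_gt with h | h
  · obtain ⟨y, hy⟩ := aux (neg_pos.2 h)
    exact ⟨-y, by rw [mul_neg, ← neg_mul, hy]⟩
  · exact aux h

noncomputable instance : Field (RatNum M) :=
  IsField.toField ⟨⟨0, 1, zero_ne_one⟩, mul_comm, exists_mul_eq_one⟩

/-- The embedding of the natural numbers of a model into its rational numbers. -/
def ofN (n : M.N) : RatNum M := mk ⟨n, 0, 0⟩

theorem ofN_nonneg (n : M.N) : 0 ≤ ofN n := mk_nonneg.2 zero_le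

@[simp] theorem ofN_add (m n : M.N) : ofN (m + n) = ofN m + ofN n := by
  simp only [ofN, ← mk_add, mk_eq_mk, Frac.add_def]; ring

@[simp] theorem ofN_mul (m n : M.N) : ofN (m * n) = ofN m * ofN n := by
  simp only [ofN, ← mk_mul, mk_eq_mk, Frac.mul_def]; ring

@[simp] theorem ofN_zero : ofN (0 : M.N) = 0 := rfl

@[simp] theorem ofN_one : ofN (1 : M.N) = 1 := rfl

@[simp] theorem ofN_le {m n : M.N} : ofN m ≤ ofN n ↔ m ≤ n := by
  rw [ofN, ofN, mk_le_mk]; simp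

theorem mk_mul_den (p : Frac M) : mk p * (ofN p.den + 1) = ofN p.pos - ofN p.neg := by
  rw [← ofN_one, ← ofN_add, ofN, ofN, ofN, ← mk_mul, ← mk_sub, mk_eq_mk]
  simp only [Frac.add_def, Frac.mul_def, Frac.sub_def, Frac.neg_def]
  ring

theorem ofN_add_one_pos (n : M.N) : 0 < ofN n + 1 := by
  have := ofN_nonneg n
  positivity

theorem mk_eq_div (p : Frac M) : mk p = (ofN p.pos - ofN p.neg) / (ofN p.den + 1) := by
  rw [eq_div_iff (ofN_add_one_pos _).ne', mk_mul_den]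

/-- Clearing the denominator of `p` gives both coded inequalities at once; in multiplied form `m =
0` is no exception. -/
theorem absLeInv_iff {p : Frac M} {m : M.N} : p.AbsLeInv m ↔ |mk p| * ofN m ≤ 1 := by
  have hd := ofN_add_one_pos p.den
  have hm := ofN_nonneg m
  rw [mk_eq_div, abs_div, abs_of_pos hd, div_mul_eq_mul_div, div_le_one hd]
  nth_rw 1 [← abs_of_nonneg hm]
  rw [← abs_mul, abs_le, Frac.AbsLeInv, le_iff_le, le_iff_le, succ_eq]
  simp only [← ofN_le, ofN_add, ofN_mul, ofN_one]
  constructor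
  · rintro ⟨h1, h2⟩
    constructor <;> linarith
  · rintro ⟨h1, h2⟩
    constructor <;> linarith

/-- The Archimedean property relative to the numbers of the model: a positive fraction has numerator
at least `1`, so its own denominator serves. -/
theorem exists_inv_le {ε : RatNum M} (hε : 0 < ε) : ∃ m : M.N, 1 ≤ ε * (ofN m + 1) := by
  obtain ⟨p, rfl⟩ := exists_mk ε
  refine ⟨p.den, ?_⟩
  rw [mk_mul_den]
  obtain ⟨a, ha⟩ := lt_iff_add_one_le.1 (mk_pos.1 hε)
  have := ofN_nonneg a
  rw [← ha]
  simp only [ofN_add, ofN_one]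
  linarith

end RatNum

/-! ### Null sequences -/

theorem isNull_iff {x : M.N → Frac M} :
    IsNull x ↔ ∀ ε > 0, ∃ K, ∀ k ≥ K, |RatNum.mk (x k)| ≤ ε := by
  simp only [IsNull, RatNum.absLeInv_iff, le_iff_le, succ_eq, RatNum.ofN_add, RatNum.ofN_one]
  constructor
  · intro h ε hε
    obtain ⟨m, hm⟩ := RatNum.exists_inv_le hε
    obtain ⟨K, hK⟩ := h m
    exact ⟨K, fun k hk => le_of_mul_le_mul_right ((hK k hk).trans hm) (RatNum.ofN_add_one_pos m)⟩
  · intro h m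
    have hm := RatNum.ofN_add_one_pos m
    obtain ⟨K, hK⟩ := h (1 / (RatNum.ofN m + 1)) (by positivity)
    exact ⟨K, fun k hk => (le_div_iff₀ hm).1 (hK k hk)⟩

end RatField
end ArithStructure

/-! ### Complex limits as a reduced quotient ring. -/

namespace ArithStructure

variable {M : ArithStructure.{u}}

noncomputable section Complex

set_option linter.unusedSectionVars false

variable [hM : Fact M.IsModelRCA0]

/-! ### Complex rational numbers -/

variable (M) in
/-- The complex rational numbers of a model. -/
abbrev GaussNum : Type u := QuadraticAlgebra (RatNum M) (-1) 0

namespace GaussNum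

/-- The complex rational number with a given code. -/
def mk (z : CFrac M) : GaussNum M := ⟨RatNum.mk z.re, RatNum.mk z.im⟩

theorem mk_zero : mk (0 : CFrac M) = 0 := rfl
theorem mk_one : mk (1 : CFrac M) = 1 := rfl
theorem mk_add (z w : CFrac M) : mk (z + w) = mk z + mk w := rfl

theorem mk_sub (z w : CFrac M) : mk (z - w) = mk z - mk w :=
  QuadraticAlgebra.ext (RatNum.mk_sub _ _) (RatNum.mk_sub _ _)

theorem mk_mul (z w : CFrac M) : mk (z * w) = mk z * mk w := by
  refine QuadraticAlgebra.ext ?_ ?_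
  · change RatNum.mk (z.re * w.re - z.im * w.im) = _
    simp only [mk, RatNum.mk_sub, RatNum.mk_mul, QuadraticAlgebra.re_mul]
    ring
  · change RatNum.mk (z.re * w.im + z.im * w.re) = _
    simp only [mk, RatNum.mk_add, RatNum.mk_mul, QuadraticAlgebra.im_mul]
    ring

/-- The taxicab norm. -/
def size (z : GaussNum M) : RatNum M := |z.re| + |z.im|

theorem size_nonneg (z : GaussNum M) : 0 ≤ size z := by unfold size; positivity

theorem size_zero : size (0 : GaussNum M) = 0 := by simp [size]

theorem size_one : size (1 : GaussNum M) = 1 := by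
  simp [size, QuadraticAlgebra.re_one, QuadraticAlgebra.im_one]

theorem size_neg (z : GaussNum M) : size (-z) = size z := by simp [size]

theorem size_add_le (z w : GaussNum M) : size (z + w) ≤ size z + size w := by
  simp only [size, QuadraticAlgebra.re_add, QuadraticAlgebra.im_add]
  linarith [abs_add_le z.re w.re, abs_add_le z.im w.im]

theorem size_mul_le (z w : GaussNum M) : size (z * w) ≤ size z * size w := by
  simp only [size, QuadraticAlgebra.re_mul, QuadraticAlgebra.im_mul]
  have h1 := abs_add_le (z.re * w.re) (-1 * z.im * w.im)
  have h2 := abs_add_le (z.re * w.im) (z.im * w.re)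
  simp only [abs_mul, abs_neg, abs_one] at h1 h2
  rw [zero_mul, zero_mul, add_zero]
  linarith

/-- The form `re² + im²` is multiplicative and agrees with the square of `size` up to a factor `2`.
This converse of submultiplicativity allows cancellation of factors bounded away from zero. -/
theorem size_mul_size_le (z w : GaussNum M) : size z * size w ≤ 2 * size (z * w) := by
  have key (z : GaussNum M) : z.re ^ 2 + z.im ^ 2 ≤ size z ^ 2 ∧
      size z ^ 2 ≤ 2 * (z.re ^ 2 + z.im ^ 2) := by
    rw [← sq_abs z.re, ← sq_abs z.im, size]
    have h1 := abs_nonneg z.re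
    have h2 := abs_nonneg z.im
    constructor <;> nlinarith [sq_nonneg (|z.re| - |z.im|)]
  have hm : (z * w).re ^ 2 + (z * w).im ^ 2 = (z.re ^ 2 + z.im ^ 2) * (w.re ^ 2 + w.im ^ 2) := by
    simp only [QuadraticAlgebra.re_mul, QuadraticAlgebra.im_mul]; ring
  refine le_of_pow_le_pow_left₀ two_ne_zero (by have := size_nonneg (z * w); positivity) ?_
  calc (size z * size w) ^ 2 = size z ^ 2 * size w ^ 2 := by ring
    _ ≤ (2 * (z.re ^ 2 + z.im ^ 2)) * (2 * (w.re ^ 2 + w.im ^ 2)) :=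
      mul_le_mul (key z).2 (key w).2 (sq_nonneg _) (by positivity)
    _ = 4 * ((z * w).re ^ 2 + (z * w).im ^ 2) := by rw [hm]; ring
    _ ≤ 4 * size (z * w) ^ 2 := by linarith [(key (z * w)).1]
    _ = (2 * size (z * w)) ^ 2 := by ring

end GaussNum

/-! ### Bounded sequences modulo null sequences -/

variable (M) in
/-- The ring of bounded sequences of complex rational numbers. -/
def boundedSeq : Subring (M.N → GaussNum M) where
  carrier := {z | ∃ C, ∀ k, GaussNum.size (z k) ≤ C}
  zero_mem' := ⟨0, fun _ => GaussNum.size_zero.le⟩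
  one_mem' := ⟨1, fun _ => GaussNum.size_one.le⟩
  add_mem' := by
    rintro z w ⟨C, hC⟩ ⟨D, hD⟩
    exact ⟨C + D, fun k => (GaussNum.size_add_le _ _).trans (add_le_add (hC k) (hD k))⟩
  mul_mem' := by
    rintro z w ⟨C, hC⟩ ⟨D, hD⟩
    exact ⟨C * D, fun k => (GaussNum.size_mul_le _ _).trans (mul_le_mul (hC k) (hD k)
      (GaussNum.size_nonneg _) ((GaussNum.size_nonneg _).trans (hC k)))⟩
  neg_mem' := by
    rintro z ⟨C, hC⟩
    exact ⟨C, fun k => (GaussNum.size_neg _).trans_le (hC k)⟩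

/-- Convergence to `0`. -/
def TendsZero (z : M.N → GaussNum M) : Prop := ∀ ε > 0, ∃ K, ∀ k ≥ K, GaussNum.size (z k) ≤ ε

variable (M) in
/-- The ideal of null sequences. -/
def nullIdeal : Ideal (boundedSeq M) where
  carrier := {z | TendsZero z.1}
  zero_mem' := fun ε hε => ⟨0, fun k _ => GaussNum.size_zero.trans_le hε.le⟩
  add_mem' := by
    rintro z w hz hw ε hε
    obtain ⟨K, hK⟩ := hz (ε / 2) (by positivity)
    obtain ⟨L, hL⟩ := hw (ε / 2) (by positivity)
    refine ⟨max K L, fun k hk => (GaussNum.size_add_le _ _).trans ?_⟩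
    linarith [hK k ((le_max_left _ _).trans hk), hL k ((le_max_right _ _).trans hk)]
  smul_mem' := by
    rintro ⟨z, C, hC⟩ w hw ε hε
    have hC0 : 0 ≤ C := (GaussNum.size_nonneg _).trans (hC 0)
    obtain ⟨K, hK⟩ := hw (ε / (C + 1)) (by positivity)
    refine ⟨K, fun k hk => (GaussNum.size_mul_le _ _).trans ?_⟩
    calc _ ≤ C * (ε / (C + 1)) := mul_le_mul (hC k) (hK k hk) (GaussNum.size_nonneg _) hC0
      _ ≤ (C + 1) * (ε / (C + 1)) := by gcongr; linarith
      _ = ε := by field_simp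

variable (M) in
/-- Bounded sequences of complex rational numbers modulo null sequences. -/
abbrev LimitRing : Type u := boundedSeq M ⧸ nullIdeal M

/-- The class of a bounded sequence. -/
def lim (z : boundedSeq M) : LimitRing M := Ideal.Quotient.mk (nullIdeal M) z

theorem lim_mul (z w : boundedSeq M) : lim (z * w) = lim z * lim w := rfl
theorem lim_one : lim (1 : boundedSeq M) = 1 := rfl

theorem lim_eq_lim {z w : boundedSeq M} : lim z = lim w ↔ TendsZero (z.1 - w.1) :=
  Ideal.Quotient.eq

theorem lim_eq_zero {z : boundedSeq M} : lim z = 0 ↔ TendsZero z.1 :=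
  Ideal.Quotient.eq_zero_iff_mem

/-- Bounded sequences need not converge, so `LimitRing` need not be a domain; an eventual lower
bound on `v` replaces `lim v ≠ 0`. -/
theorem eq_zero_of_mul_eq_zero {v : boundedSeq M} {δ : RatNum M} (hδ : 0 < δ) {K : M.N}
    (hv : ∀ k ≥ K, δ ≤ GaussNum.size (v.1 k)) {w : boundedSeq M} (h : lim w * lim v = 0) :
    lim w = 0 := by
  rw [← lim_mul, lim_eq_zero] at h
  rw [lim_eq_zero]
  intro ε hε
  obtain ⟨L, hL⟩ := h (δ * ε / 2) (by positivity)
  refine ⟨max K L, fun k hk => ?_⟩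
  have h1 := hv k ((le_max_left _ _).trans hk)
  have h2 : GaussNum.size (w.1 k * v.1 k) ≤ _ := hL k ((le_max_right _ _).trans hk)
  refine le_of_mul_le_mul_left ?_ hδ
  calc δ * GaussNum.size (w.1 k) ≤ GaussNum.size (v.1 k) * GaussNum.size (w.1 k) :=
        mul_le_mul_of_nonneg_right h1 (GaussNum.size_nonneg _)
    _ = GaussNum.size (w.1 k) * GaussNum.size (v.1 k) := mul_comm _ _
    _ ≤ 2 * GaussNum.size (w.1 k * v.1 k) := GaussNum.size_mul_size_le _ _
    _ ≤ δ * ε := by linarith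

/-- By `size_mul_size_le`, `size z ^ 2 ≤ 2 * size (z * z)`, so a null square forces a null sequence.
-/
instance : IsReduced (LimitRing M) := by
  rw [isReduced_iff_pow_one_lt 2 one_lt_two]
  intro x hx
  obtain ⟨z, rfl⟩ := Ideal.Quotient.mk_surjective x
  change lim z ^ 2 = 0 at hx
  change lim z = 0
  rw [sq, ← lim_mul, lim_eq_zero] at hx
  rw [lim_eq_zero]
  intro ε hε
  obtain ⟨K, hK⟩ := hx (ε ^ 2 / 2) (by positivity)
  refine ⟨K, fun k hk => ?_⟩
  have h1 : GaussNum.size (z.1 k * z.1 k) ≤ _ := hK k hk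
  refine le_of_pow_le_pow_left₀ two_ne_zero hε.le ?_
  rw [sq]
  linarith [GaussNum.size_mul_size_le (z.1 k) (z.1 k)]

/-- The representatives `z`, `w` are left free so that termwise sums and products of codes can be
matched with ring expressions. -/
theorem ceq_iff {x y : M.N → CFrac M} {z w : boundedSeq M} (hx : ∀ k, z.1 k = GaussNum.mk (x k))
    (hy : ∀ k, w.1 k = GaussNum.mk (y k)) : CEq x y ↔ lim z = lim w := by
  rw [lim_eq_lim]
  have hs (k : M.N) : (z.1 - w.1) k = GaussNum.mk (x k - y k) := by
    rw [GaussNum.mk_sub, Pi.sub_apply, hx, hy]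
  unfold TendsZero
  simp only [hs, CEq, isNull_iff, GaussNum.size, GaussNum.mk]
  constructor
  · rintro ⟨h1, h2⟩ ε hε
    obtain ⟨K, hK⟩ := h1 (ε / 2) (by positivity)
    obtain ⟨L, hL⟩ := h2 (ε / 2) (by positivity)
    refine ⟨max K L, fun k hk => ?_⟩
    linarith [hK k ((le_max_left _ _).trans hk), hL k ((le_max_right _ _).trans hk)]
  · intro h
    constructor
    · intro ε hε
      obtain ⟨K, hK⟩ := h ε hε
      exact ⟨K, fun k hk => (le_add_of_nonneg_right (abs_nonneg _)).trans (hK k hk)⟩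
    · intro ε hε
      obtain ⟨K, hK⟩ := h ε hε
      exact ⟨K, fun k hk => (le_add_of_nonneg_left (abs_nonneg _)).trans (hK k hk)⟩

/-! ### Quickly converging sequences -/

theorem isQuick_iff {x : M.N → Frac M} : IsQuick x ↔
    ∀ k i, |RatNum.mk (x k) - RatNum.mk (x (k + i))| * RatNum.ofN (M.pow2 k) ≤ 1 := by
  simp only [IsQuick, RatNum.absLeInv_iff, RatNum.mk_sub]

theorem IsQuick.abs_le {x : M.N → Frac M} (hx : IsQuick x) (k : M.N) :
    |RatNum.mk (x k)| ≤ |RatNum.mk (x 0)| + 1 := by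
  have := isQuick_iff.1 hx 0 k
  rw [pow2_zero, RatNum.ofN_one, mul_one, zero_add] at this
  have h2 := abs_sub_abs_le_abs_sub (RatNum.mk (x k)) (RatNum.mk (x 0))
  rw [abs_sub_comm] at h2
  linarith

/-- The bounded sequence of complex rational numbers given by two quickly converging sequences. -/
def quickSeq (x : M.N → CFrac M) (hre : IsQuick fun k => (x k).re)
    (him : IsQuick fun k => (x k).im) : boundedSeq M :=
  ⟨fun k => GaussNum.mk (x k), _, fun k => add_le_add (hre.abs_le k) (him.abs_le k)⟩

theorem IsQuick.abs_sub_mul_le {x : M.N → Frac M} (hx : IsQuick x) {j k : M.N} (hjk : j ≤ k) :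
    |RatNum.mk (x j) - RatNum.mk (x k)| * (RatNum.ofN j + 1) ≤ 1 := by
  obtain ⟨i, rfl⟩ := hjk
  refine le_trans ?_ (isQuick_iff.1 hx j i)
  gcongr
  rw [← RatNum.ofN_one, ← RatNum.ofN_add, RatNum.ofN_le]
  exact add_one_le_pow2 j

/-- A quickly converging sequence with non-zero limit is bounded away from zero. -/
theorem exists_le_size_of_ne_zero {x : M.N → CFrac M} (hre : IsQuick fun k => (x k).re)
    (him : IsQuick fun k => (x k).im) (h : lim (quickSeq x hre him) ≠ 0) :
    ∃ δ > 0, ∃ K, ∀ k ≥ K, δ ≤ GaussNum.size ((quickSeq x hre him).1 k) := by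
  rw [Ne, lim_eq_zero, TendsZero] at h
  push Not at h
  obtain ⟨ε, hε, h⟩ := h
  -- Past an index `j ≥ m` where the size exceeds `ε`, each of the two coordinates moves by at most
  -- `ε / 4`, so at least `ε / 2` remains.
  obtain ⟨m, hm⟩ := RatNum.exists_inv_le (show 0 < ε / 4 by positivity)
  obtain ⟨j, hj, hjε⟩ := h m
  refine ⟨ε / 2, by positivity, j, fun k hk => ?_⟩
  have hmj : RatNum.ofN m ≤ RatNum.ofN j := RatNum.ofN_le.2 hj
  have hp := RatNum.ofN_add_one_pos m
  have key {y : M.N → Frac M} (hy : IsQuick y) :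
      |RatNum.mk (y j) - RatNum.mk (y k)| ≤ ε / 4 := by
    refine le_of_mul_le_mul_right ?_ hp
    refine le_trans ?_ hm
    refine le_trans ?_ (hy.abs_sub_mul_le hk)
    gcongr
  have h1 := key hre
  have h2 := key him
  change ε < |_| + |_| at hjε
  change _ ≤ |RatNum.mk (x k).re| + |RatNum.mk (x k).im|
  have h3 := abs_sub_abs_le_abs_sub (RatNum.mk (x j).re) (RatNum.mk (x k).re)
  have h4 := abs_sub_abs_le_abs_sub (RatNum.mk (x j).im) (RatNum.mk (x k).im)
  change ε < |RatNum.mk (x j).re| + |RatNum.mk (x j).im| at hjε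
  linarith

/-- At index `2` the bound `1 / (j + 1)` gives error at most `1/3` against a later term, itself
within `1/8` of `c`; the total is `11/24`. -/
theorem IsQuick.abs_sub_lt_half {x : M.N → Frac M} (hx : IsQuick x) {c : RatNum M}
    (hc : ∀ ε > 0, ∃ K, ∀ k ≥ K, |RatNum.mk (x k) - c| ≤ ε) :
    |RatNum.mk (x (1 + 1)) - c| < 1 / 2 := by
  have aux {a b d : RatNum M} (h1 : b ≤ 1 / 8) (h2 : d * 3 ≤ 1) (h3 : a ≤ d + b) : a < 1 / 2 := by
    linarith
  obtain ⟨K, hK⟩ := hc (1 / 8) (by positivity)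
  have h2 := hx.abs_sub_mul_le (le_max_right K (1 + 1))
  simp only [RatNum.ofN_add, RatNum.ofN_one] at h2
  rw [show (1 + 1 + 1 : RatNum M) = 3 by norm_num] at h2
  exact aux (hK (max K (1 + 1)) (le_max_left _ _)) h2 (abs_sub_le _ _ _)

end Complex
end ArithStructure

/-- A Jordan decomposition of the matrix `(0, x; 0, 0)` over a reduced ring decides whether `x = 0`. -/
theorem jordan_nilpotent_dichotomy {R : Type*} [CommRing R] [IsReduced R] {x : R}
    {U V J : Matrix (Fin 2) (Fin 2) R} (hVU : V * U = 1)
    (hA : !![0, x; 0, 0] = U * J * V)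
    (hJ : (J 0 1 = 0 ∧ J 1 0 = 0) ∨ (J 0 0 = J 1 1 ∧ J 0 1 = 1 ∧ J 1 0 = 0)) :
    (x = 0 ∧ J 0 1 = 0) ∨ (x ≠ 0 ∧ J 0 1 = 1) := by
  have hJA : J = V * !![0, x; 0, 0] * U := by
    rw [hA]
    calc J = 1 * J * 1 := by simp
      _ = (V * U) * J * (V * U) := by rw [hVU]
      _ = V * (U * J * V) * U := by simp only [Matrix.mul_assoc]
  by_cases hx : x = 0
  · left
    refine ⟨hx, ?_⟩
    rw [hJA, hx]
    simp [Matrix.mul_apply, Fin.sum_univ_two]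
  · right
    refine ⟨hx, ?_⟩
    rcases hJ with ⟨h01, h10⟩ | ⟨-, h, -⟩
    -- A diagonal `J` has `U J² V = A² = 0`, hence `J² = 0`; reducedness kills its diagonal entries,
    -- so `J = 0` and `x = 0`.
    · exfalso
      have hsq : U * (J * J) * V = 0 := by
        calc U * (J * J) * V = (U * J) * 1 * (J * V) := by simp only [Matrix.mul_assoc, Matrix.one_mul]
          _ = (U * J * V) * (U * J * V) := by rw [← hVU]; simp only [Matrix.mul_assoc]
          _ = 0 := by
            rw [← hA]
            ext r c
            fin_cases r <;> fin_cases c <;> simp [Matrix.mul_apply, Fin.sum_univ_two]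
      have hJJ : J * J = 0 := by
        calc J * J = (V * U) * (J * J) * (V * U) := by rw [hVU]; simp
          _ = V * (U * (J * J) * V) * U := by simp only [Matrix.mul_assoc]
          _ = 0 := by rw [hsq]; simp
      have h00 : J 0 0 = 0 := by
        have := congrFun₂ hJJ 0 0
        rw [Matrix.mul_apply, Fin.sum_univ_two, h01, zero_mul, add_zero] at this
        exact IsReduced.eq_zero _ ⟨2, (sq _).trans this⟩
      have h11 : J 1 1 = 0 := by
        have := congrFun₂ hJJ 1 1
        rw [Matrix.mul_apply, Fin.sum_univ_two, h01, mul_zero, zero_add] at this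
        exact IsReduced.eq_zero _ ⟨2, (sq _).trans this⟩
      have hJ0 : J = 0 := by
        ext r c
        fin_cases r <;> fin_cases c <;> assumption
      rw [hJ0, Matrix.mul_zero, Matrix.zero_mul] at hA
      exact hx (by simpa using congrFun₂ hA 0 1)
    · exact h

/-! ### From the Jordan principle to `Σ⁰₁` comprehension. -/

namespace ArithStructure

variable {M : ArithStructure.{u}}

section Reversal

set_option linter.unusedSectionVars false

variable [hM : Fact M.IsModelRCA0]

/-! ### A real number that is zero if and only if a search fails -/

/-- The `k`-th approximation is halved at each stage until a zero of `f (i, ·)` is seen and is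
frozen from then on: `2^(-k)` while the search fails, a fixed positive number afterwards. -/
theorem exists_search_real {f : M.N → M.N} (hf : f ∈ M.Fn) :
    ∃ d ∈ M.Fn, ∀ i, IsQuick (fun k => (⟨1, 0, d (M.pair i k)⟩ : Frac M)) ∧
      (IsNull (fun k => (⟨1, 0, d (M.pair i k)⟩ : Frac M)) ↔ ¬ ∃ k, f (M.pair i k) = 0) := by
  obtain ⟨c, hc, hcf⟩ := (Decid.of_eq hf (mem_const 0)).not.exists_char
  -- The flag `q (i, k)` is `1` as long as no zero has occurred below `k`, and `0` from then on.
  obtain ⟨q, hq, hq0, hqs⟩ := exists_mem_recur (mem_const 1)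
    (mem_mul mem_fst (mem_comp hc mem_snd))
  -- This doubles the true denominator `d + 1` while the flag at the next stage is still `1`, and
  -- leaves `d` unchanged otherwise.
  have hstep : (fun z : M.N => fst z + q (M.pair (fst (snd z)) (snd (snd z) + 1)) * (fst z + 1))
      ∈ M.Fn :=
    mem_add mem_fst (mem_mul (mem_comp hq (mem_pair (mem_comp mem_fst mem_snd)
      (mem_add (mem_comp mem_snd mem_snd) (mem_const 1)))) (mem_add mem_fst (mem_const 1)))
  obtain ⟨d, hd, hd0, hds⟩ := exists_mem_recur (mem_const 0) hstep
  simp only [fst_pair, snd_pair] at hqs hds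
  refine ⟨d, hd, fun i => ?_⟩
  have hi : (fun k => M.pair i k) ∈ M.Fn := mem_pair (mem_const i) mem_id
  have hc01 (x : M.N) : c x = 0 ∨ c x = 1 := by
    by_cases h : f x = 0
    · exact .inl ((hcf x).2 (not_not.2 h))
    · exact .inr ((hcf x).1 h)
  have hq01 (k : M.N) : q (M.pair i k) = 0 ∨ q (M.pair i k) = 1 := by
    refine Decid.induct (P := fun k => q (M.pair i k) = 0 ∨ q (M.pair i k) = 1)
      ((Decid.of_eq (mem_comp hq hi) (mem_const 0)).or
        (Decid.of_eq (mem_comp hq hi) (mem_const 1))) (.inr (hq0 i)) (fun k hk => ?_) k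
    rw [hqs]
    rcases hk with hk | hk <;> rcases hc01 (M.pair i k) with h | h <;> simp [hk, h]
  have hpow (k : M.N) : q (M.pair i k) = 0 ∨ d (M.pair i k) + 1 = M.pow2 k := by
    refine Decid.induct (P := fun k => q (M.pair i k) = 0 ∨ d (M.pair i k) + 1 = M.pow2 k)
      ((Decid.of_eq (mem_comp hq hi) (mem_const 0)).or
        (Decid.of_eq (mem_add (mem_comp hd hi) (mem_const 1)) mem_pow2))
      (.inr (by rw [hd0, pow2_zero, zero_add])) (fun k hk => ?_) k
    rcases hk with hk | hk
    · left; rw [hqs, hk, zero_mul]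
    · rcases hq01 (k + 1) with h | h
      · exact .inl h
      · right
        rw [hds, h, pow2_add_one, ← hk]
        ring
  have hstay (k : M.N) (hk : q (M.pair i k) = 0) (j : M.N) :
      q (M.pair i (k + j)) = 0 ∧ d (M.pair i (k + j)) = d (M.pair i k) := by
    have hkj : (fun j => M.pair i (k + j)) ∈ M.Fn :=
      mem_pair (mem_const i) (mem_add (mem_const k) mem_id)
    refine Decid.induct
      (P := fun j => q (M.pair i (k + j)) = 0 ∧ d (M.pair i (k + j)) = d (M.pair i k))
      ((Decid.of_eq (mem_comp hq hkj) (mem_const 0)).and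
        (Decid.of_eq (mem_comp hd hkj) (mem_const _))) (by simp [hk]) (fun j hj => ?_) j
    rw [← add_assoc, hqs, hds, hqs, hj.1, hj.2]
    simp
  have hmono (k j : M.N) : d (M.pair i k) ≤ d (M.pair i (k + j)) := by
    refine Decid.induct (P := fun j => d (M.pair i k) ≤ d (M.pair i (k + j)))
      (Decid.of_le (mem_const _) (mem_comp hd (mem_pair (mem_const i)
        (mem_add (mem_const k) mem_id)))) (by simp) (fun j hj => hj.trans ?_) j
    rw [← add_assoc, hds]
    exact le_self_add
  have hmk (k : M.N) : RatNum.mk (⟨1, 0, d (M.pair i k)⟩ : Frac M) =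
      1 / (RatNum.ofN (d (M.pair i k)) + 1) := by
    rw [RatNum.mk_eq_div]; simp
  refine ⟨isQuick_iff.2 fun k j => ?_, ⟨?_, ?_⟩⟩
  -- Either the sequence is already constant from `k` on, or its `k`-th term is exactly `2^(-k)` and
  -- later terms are positive and no larger.
  · rcases hpow k with h | h
    · rw [(hstay k h j).2]
      simp
    · have h0 := RatNum.ofN_add_one_pos (d (M.pair i k))
      have h1 := RatNum.ofN_add_one_pos (d (M.pair i (k + j)))
      have h2 : RatNum.ofN (d (M.pair i k)) ≤ RatNum.ofN (d (M.pair i (k + j))) :=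
        RatNum.ofN_le.2 (hmono k j)
      have h3 : 1 / (RatNum.ofN (d (M.pair i (k + j))) + 1) ≤ 1 / (RatNum.ofN (d (M.pair i k)) + 1) :=
        one_div_le_one_div_of_le h0 (by linarith)
      rw [hmk, hmk, ← h, abs_of_nonneg (by linarith), RatNum.ofN_add, RatNum.ofN_one, sub_mul,
        one_div_mul_cancel h0.ne']
      have : 0 ≤ 1 / (RatNum.ofN (d (M.pair i (k + j))) + 1) * (RatNum.ofN (d (M.pair i k)) + 1) := by
        positivity
      linarith
  · rintro hnull ⟨k, hk⟩
    -- A zero of `f` at `k` reaches the flag only at stage `k + 1`.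
    have hq' : q (M.pair i (k + 1)) = 0 := by rw [hqs, (hcf _).2 (not_not.2 hk), mul_zero]
    have h0 := RatNum.ofN_add_one_pos (d (M.pair i (k + 1)))
    obtain ⟨K, hK⟩ := isNull_iff.1 hnull (1 / (RatNum.ofN (d (M.pair i (k + 1))) + 1) / 2)
      (by positivity)
    have := hK (k + 1 + K) le_add_self
    have hp : 0 < 1 / (RatNum.ofN (d (M.pair i (k + 1))) + 1) := by positivity
    rw [hmk, (hstay _ hq' K).2, abs_of_pos hp] at this
    linarith
  · intro hno
    have hq1 (k : M.N) : q (M.pair i k) = 1 := by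
      refine Decid.induct (P := fun k => q (M.pair i k) = 1)
        (Decid.of_eq (mem_comp hq hi) (mem_const 1)) (hq0 i) (fun k hk => ?_) k
      rw [hqs, hk, (hcf _).1 (fun h => hno ⟨k, h⟩), one_mul]
    refine isNull_iff.2 fun ε hε => ?_
    obtain ⟨m, hm⟩ := RatNum.exists_inv_le hε
    refine ⟨m, fun k hk => ?_⟩
    have h0 := RatNum.ofN_add_one_pos (d (M.pair i k))
    have hle : m + 1 ≤ d (M.pair i k) + 1 := by
      rw [(hpow k).resolve_left (by rw [hq1]; exact one_ne_zero)]
      exact (add_le_add_left hk 1).trans (add_one_le_pow2 k)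
    have hle' : RatNum.ofN m + 1 ≤ RatNum.ofN (d (M.pair i k)) + 1 := by
      simpa only [RatNum.ofN_add, RatNum.ofN_one] using RatNum.ofN_le.2 hle
    rw [hmk, abs_of_pos (by positivity), div_le_iff₀ h0]
    exact hm.trans (mul_le_mul_of_nonneg_left hle' hε.le)

/-! ### Matrices -/

theorem isQuick_zero : IsQuick (fun _ => (0 : Frac M)) := by
  rw [isQuick_iff]; simp

theorem lim_congr {z w : boundedSeq M} (h : ∀ k, z.1 k = w.1 k) : lim z = lim w := by
  rw [Subtype.ext (funext h)]

/-- From `A² = 0` the eigenvalue satisfies `l² v = 0`. A nonzero coordinate of `v` is bounded away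
from zero and can be cancelled, and reducedness gives `l = 0`. -/
theorem hasOnlyRealEigenvalues_nilpotent {A : Mat2 M} {a : Fin 2 → Fin 2 → boundedSeq M}
    (ha : ∀ r c k, (a r c).1 k = GaussNum.mk (A r c k)) (h00 : lim (a 0 0) = 0)
    (h1 : ∀ c, lim (a 1 c) = 0) : Mat2.HasOnlyRealEigenvalues A := by
  intro l v hl hv hv0 heq
  let b : boundedSeq M := quickSeq l.term hl.1 hl.2
  let w (r : Fin 2) : boundedSeq M := quickSeq (v r).term (hv r).1 (hv r).2
  have key (r : Fin 2) : lim (a r 0) * lim (w 0) + lim (a r 1) * lim (w 1) = lim b * lim (w r) := by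
    refine (ceq_iff (z := a r 0 * w 0 + a r 1 * w 1) (w := b * w r) ?_ ?_).1 (heq r)
    · intro k
      rw [GaussNum.mk_add, GaussNum.mk_mul, GaussNum.mk_mul, ← ha, ← ha]
      rfl
    · intro k
      rw [GaussNum.mk_mul]
      rfl
  have k0 := key 0
  have k1 := key 1
  rw [h1, h1, zero_mul, zero_mul, add_zero] at k1
  rw [h00, zero_mul, zero_add] at k0
  have hsq (r : Fin 2) : lim (b * b) * lim (w r) = 0 := by
    rw [lim_mul, mul_assoc]
    fin_cases r
    · change lim b * (lim b * lim (w 0)) = 0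
      rw [← k0, mul_left_comm, ← k1, mul_zero]
    · change lim b * (lim b * lim (w 1)) = 0
      rw [← k1, mul_zero]
  obtain ⟨r, hr⟩ := not_forall.1 hv0
  have hw : lim (w r) ≠ 0 := by
    intro h
    exact hr ((ceq_iff (z := w r) (w := 0) (fun _ => rfl) (fun _ => rfl)).2 h)
  obtain ⟨δ, hδ, K, hK⟩ := exists_le_size_of_ne_zero _ _ hw
  have hb := eq_zero_of_mul_eq_zero hδ hK (hsq r)
  rw [lim_mul] at hb
  replace hb := lim_eq_zero.1 (IsReduced.eq_zero _ ⟨2, (sq _).trans hb⟩)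
  rw [isNull_iff]
  intro ε hε
  obtain ⟨L, hL⟩ := hb ε hε
  exact ⟨L, fun k hk => (le_add_of_nonneg_left (abs_nonneg _)).trans (hL k hk)⟩

theorem lim_matrix_mul {A B C : Mat2 M} {a b c : Fin 2 → Fin 2 → boundedSeq M}
    (ha : ∀ r s k, (a r s).1 k = GaussNum.mk (A r s k))
    (hb : ∀ r s k, (b r s).1 k = GaussNum.mk (B r s k))
    (hc : ∀ r s k, (c r s).1 k = GaussNum.mk (C r s k)) :
    Mat2.MEq (Mat2.mul A B) C ↔
      Matrix.of (fun r s => lim (a r s)) * Matrix.of (fun r s => lim (b r s)) =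
        Matrix.of (fun r s => lim (c r s)) := by
  rw [← Matrix.ext_iff]
  refine forall₂_congr fun r s => ?_
  rw [Matrix.mul_apply, Fin.sum_univ_two]
  refine ceq_iff (z := a r 0 * b 0 s + a r 1 * b 1 s) (w := c r s) (fun k => ?_) (hc r s)
  simp only [Mat2.mul, GaussNum.mk_add, GaussNum.mk_mul, ← ha, ← hb]
  rfl

/-- Transfer of `jordan_nilpotent_dichotomy` to coded matrices. The inverse `V` is used only for
this single decomposition, so no sequence of inverses is needed. -/
theorem lim_jordan_dichotomy {A U J : Mat2 M} {a u j : Fin 2 → Fin 2 → boundedSeq M}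
    (ha : ∀ r s k, (a r s).1 k = GaussNum.mk (A r s k))
    (hu : ∀ r s k, (u r s).1 k = GaussNum.mk (U r s k))
    (hj : ∀ r s k, (j r s).1 k = GaussNum.mk (J r s k)) (h00 : lim (a 0 0) = 0)
    (h1 : ∀ c, lim (a 1 c) = 0) (h : Mat2.IsJordanDecomposition A U J) :
    (lim (a 0 1) = 0 ∧ lim (j 0 1) = 0) ∨ (lim (a 0 1) ≠ 0 ∧ lim (j 0 1) = 1) := by
  obtain ⟨hJ, V, hV, -, hVU, hA⟩ := h
  let v (r s : Fin 2) : boundedSeq M := quickSeq (V r s).term (hV r s).1 (hV r s).2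
  have hv : ∀ r s k, (v r s).1 k = GaussNum.mk ((V r s).term k) := fun _ _ _ => rfl
  have hVU' : Matrix.of (fun r s => lim (v r s)) * Matrix.of (fun r s => lim (u r s)) = 1 := by
    rw [(lim_matrix_mul (c := fun r s => if r = s then 1 else 0) hv hu ?_).1 hVU]
    · ext r s
      rw [Matrix.one_apply, Matrix.of_apply]
      split_ifs <;> rfl
    · intro r s k
      simp only [Mat2.one]
      split_ifs <;> rfl
  let uj (r s : Fin 2) : boundedSeq M := u r 0 * j 0 s + u r 1 * j 1 s
  have huj : ∀ r s k, (uj r s).1 k = GaussNum.mk (Mat2.mul U J r s k) := by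
    intro r s k
    simp only [Mat2.mul, GaussNum.mk_add, GaussNum.mk_mul, ← hu, ← hj]
    rfl
  let ujv (r s : Fin 2) : boundedSeq M := uj r 0 * v 0 s + uj r 1 * v 1 s
  have hujv : ∀ r s k, (ujv r s).1 k =
      GaussNum.mk (Mat2.mul (Mat2.mul U J) (fun r c => (V r c).term) r s k) := by
    intro r s k
    rw [Mat2.mul, GaussNum.mk_add, GaussNum.mk_mul, GaussNum.mk_mul, ← huj, ← huj]
    rfl
  have hA' : !![0, lim (a 0 1); 0, 0] = Matrix.of (fun r s => lim (u r s)) *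
      Matrix.of (fun r s => lim (j r s)) * Matrix.of (fun r s => lim (v r s)) := by
    have h2 (r s) : lim (a r s) = lim (ujv r s) := (ceq_iff (ha r s) (hujv r s)).1 (hA r s)
    have h3 : !![0, lim (a 0 1); 0, 0] = Matrix.of fun r s => lim (a r s) := by
      ext r s
      fin_cases r <;> fin_cases s <;> simp [h00, h1]
    rw [h3]
    ext r s
    simp only [Matrix.of_apply, Matrix.mul_apply, Fin.sum_univ_two, h2]
    rfl
  refine jordan_nilpotent_dichotomy (J := Matrix.of fun r s => lim (j r s)) hVU' hA' ?_
  have c0 (r s) : CEq (J r s) (fun _ => 0) ↔ lim (j r s) = 0 := ceq_iff (w := 0) (hj r s) fun _ => rfl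
  have c1 (r s) : CEq (J r s) (fun _ => 1) ↔ lim (j r s) = 1 := ceq_iff (w := 1) (hj r s) fun _ => rfl
  rw [Mat2.IsJordanForm, c0, c0, c1, ceq_iff (hj 0 0) (hj 1 1)] at hJ
  exact hJ

/-- The real part of the third approximation of a complex number decides between `0` and `1`. -/
theorem re_approx_separates_zero_one {x : M.N → CFrac M} (hre : IsQuick fun k => (x k).re)
    (him : IsQuick fun k => (x k).im) :
    (lim (quickSeq x hre him) = 0 →
      2 * (x (1 + 1)).re.pos ≤ 2 * (x (1 + 1)).re.neg + (x (1 + 1)).re.den) ∧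
    (lim (quickSeq x hre him) = 1 →
      ¬ 2 * (x (1 + 1)).re.pos ≤ 2 * (x (1 + 1)).re.neg + (x (1 + 1)).re.den) := by
  set p := (x (1 + 1)).re
  have hd := RatNum.ofN_add_one_pos p.den
  have h2 : RatNum.ofN (2 : M.N) = 2 := by
    rw [← one_add_one_eq_two, RatNum.ofN_add, RatNum.ofN_one, one_add_one_eq_two]
  constructor
  · intro h
    have key : |RatNum.mk p - 0| < 1 / 2 := hre.abs_sub_lt_half fun ε hε => by
      obtain ⟨K, hK⟩ := lim_eq_zero.1 h ε hε
      refine ⟨K, fun k hk => ?_⟩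
      rw [sub_zero]
      exact (le_add_of_nonneg_right (abs_nonneg _)).trans (hK k hk)
    rw [sub_zero, abs_lt, RatNum.mk_eq_div, div_lt_iff₀ hd] at key
    by_contra hcon
    -- For numbers of the model, failure of the inequality means `2 * neg + (den + 1) ≤ 2 * pos`,
    -- that is, a value of at least `1/2`.
    rw [not_le, lt_iff_add_one_le, ← RatNum.ofN_le] at hcon
    simp only [RatNum.ofN_add, RatNum.ofN_mul, RatNum.ofN_one, h2] at hcon
    linarith [key.2]
  · intro h hle
    have key : |RatNum.mk p - 1| < 1 / 2 := hre.abs_sub_lt_half fun ε hε => by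
      obtain ⟨K, hK⟩ := lim_eq_lim.1 (h.trans lim_one.symm) ε hε
      exact ⟨K, fun k hk => (le_add_of_nonneg_right (abs_nonneg _)).trans (hK k hk)⟩
    rw [abs_lt] at key
    have k1 : 1 / 2 < RatNum.mk p := by linarith [key.1]
    rw [RatNum.mk_eq_div, lt_div_iff₀ hd] at k1
    rw [← RatNum.ofN_le] at hle
    simp only [RatNum.ofN_add, RatNum.ofN_mul, h2] at hle
    linarith

/-- The matrix `(0, x; 0, 0)` of coded sequences. -/
def nilpotentMatrix {α : Type*} (zero x : α) : Fin 2 → Fin 2 → α := ![![zero, x], ![zero, zero]]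

theorem SequentialJordanPrinciple.sigmaComprehension (h : M.SequentialJordanPrinciple) :
    M.SigmaComprehension := by
  intro f hf
  obtain ⟨d, hd, hdf⟩ := exists_search_real hf
  let O : RatSeq M := ⟨⟨_, mem_const 0⟩, ⟨_, mem_const 0⟩, ⟨_, mem_const 0⟩⟩
  let X : RatSeq M := ⟨⟨_, mem_const 1⟩, ⟨_, mem_const 0⟩, ⟨d, hd⟩⟩
  let A := nilpotentMatrix O X
  have hO (i : M.N) : IsQuick (O.row i) := isQuick_zero
  have hX (i : M.N) : IsQuick (X.row i) := (hdf i).1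
  have hA (r c i) : IsQuick ((A r c).row i) := by
    fin_cases r <;> fin_cases c
    exacts [hO i, hX i, hO i, hO i]
  let a (i : M.N) (r c : Fin 2) : boundedSeq M :=
    quickSeq (fun k => ⟨(A r c).row i k, 0⟩) (hA r c i) isQuick_zero
  have ha00 (i : M.N) : lim (a i 0 0) = 0 := lim_congr (w := 0) fun _ => rfl
  have ha1 (i : M.N) (c : Fin 2) : lim (a i 1 c) = 0 := by
    fin_cases c <;> exact lim_congr (w := 0) fun _ => rfl
  have ha01 (i : M.N) : lim (a i 0 1) = 0 ↔ ¬ ∃ k, f (M.pair i k) = 0 := by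
    rw [← (hdf i).2, lim_eq_zero, isNull_iff]
    refine forall₂_congr fun ε _ => exists_congr fun K => forall₂_congr fun k _ => ?_
    change |RatNum.mk (⟨1, 0, d (M.pair i k)⟩ : Frac M)| + |(0 : RatNum M)| ≤ ε ↔ _
    rw [abs_zero, add_zero]
  obtain ⟨U, J, hU, hJ, hdec⟩ := h A hA
    (fun i => hasOnlyRealEigenvalues_nilpotent (a := a i) (fun _ _ _ => rfl) (ha00 i) (ha1 i))
  have key (i : M.N) := lim_jordan_dichotomy (a := a i)
    (u := fun r s => quickSeq ((U r s).row i) (hU r s i).1 (hU r s i).2)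
    (j := fun r s => quickSeq ((J r s).row i) (hJ r s i).1 (hJ r s i).2)
    (fun _ _ _ => rfl) (fun _ _ _ => rfl) (fun _ _ _ => rfl) (ha00 i) (ha1 i) (hdec i)
  have hpair : (fun i : M.N => M.pair i (1 + 1)) ∈ M.Fn := mem_pair mem_id (mem_const _)
  -- The test compares functions of the model at the code of `(i, 2)`; it is decidable uniformly in
  -- `i` because the entries of all the `J_i` are coded together.
  have hdecid := (Decid.of_le
    (mem_mul (mem_const 2) (mem_comp (J 0 1).re.pos.2 hpair))
    (mem_add (mem_mul (mem_const 2) (mem_comp (J 0 1).re.neg.2 hpair))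
      (mem_comp (J 0 1).re.den.2 hpair))).not
  convert! hdecid using 2 with i
  have hiff := re_approx_separates_zero_one (x := (J 0 1).row i) (hJ 0 1 i).1 (hJ 0 1 i).2
  rcases key i with ⟨h0, h1⟩ | ⟨h0, h1⟩
  · rw [ha01] at h0
    exact iff_of_false h0 (not_not.2 (hiff.1 h1))
  · rw [Ne, ha01, not_not] at h0
    exact iff_of_true h0 (hiff.2 h1)

end Reversal
end ArithStructure

theorem mainTheorem7 (M : ArithStructure.{u}) :
    (M.IsModelRCA0 → M.SequentialJordanPrinciple → M.ArithmeticalComprehension) ∧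
    (M.IsModelRCA → M.SequentialJordanPrinciple → M.ArithmeticalComprehension) := by
  have main (h : M.IsModelRCA0) (hJ : M.SequentialJordanPrinciple) :
      M.ArithmeticalComprehension := by
    have : Fact M.IsModelRCA0 := ⟨h⟩
    exact hJ.sigmaComprehension.arithmeticalComprehension
  exact ⟨main, fun h => main h.toIsModelRCA0⟩
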